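/- Let $\mathbb D$ be the open unit disc, let $\widetilde G$ be the universal covering group of $SU(1,1)$, acting on $\mathbb D$ through the Möbius action $z\mapsto (az+b)/(cz+d)$ of $\left(\begin{smallmatrix}a&b\\c&d\end{smallmatrix}\right)\in SU(1,1)$ ($c=\bar b$, $d=\bar a$), and let $\widetilde{\mathbb K}\subset\widetilde G$ be the stabilizer of $0$. In $\mathfrak{sl}(2,\mathbb C)$ put $h=\frac12\left(\begin{smallmatrix}1&0\\0&-1\end{smallmatrix}\right)$ and $y=\left(\begin{smallmatrix}0&0\\1&0\end{smallmatrix}\right)$, so that $[h,y]=-y$, and $\mathfrak b=\mathbb Ch+\mathbb Cy$. A homogeneous holomorphic vector bundle over $\mathbb D$ is a holomorphic vector bundle $E\to\mathbb D$ of finite rank with a smooth action of $\widetilde G$ by holomorphic bundle automorphisms (linear on fibres) lying above the action of $\widetilde G$ on $\mathbb D$; an isomorphism of two such bundles is a $\widetilde G$-equivariant holomorphic vector bundle isomorphism over the identity of $\mathbb D$. $E$ is Hermitizable if it admits a $\widetilde G$-invariant (smooth) Hermitian structure. Let $\varrho$ be the representation of $\widetilde{\mathbb K}$ on the fibre $E_0$,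 and $\varrho(h)$ the endomorphism of $E_0$ with $\varrho(\exp(ith))=\exp(it\varrho(h))$, $t\in\mathbb R$. A Hermitizable $E$ is elementary if the set of eigenvalues of $\varrho(h)$ is an uninterrupted string $\{-\eta,-(\eta+1),\dots,-(\eta+m)\}$ with some $m\ge 0$. Given $\eta\in\mathbb R$, $m\ge 0$, positive integers $d_0,\dots,d_m$ and a block lower-subdiagonal matrix $Y$ (its blocks have sizes $d_i\times d_j$, $0\le i,j\le m$, and only the blocks $Y_j$ in the positions $(j,j-1)$, $1\le j\le m$, may be nonzero), let $E^{(\eta,Y)}$ be the homogeneous holomorphic vector bundle holomorphically induced by the representation of $\mathfrak b$ on $\mathbb C^{d_0}\oplus\dots\oplus\mathbb C^{d_m}$ with $\varrho(h)=\operatorname{diag}(-\eta I_{d_0},\dots,-(\eta+m)I_{d_m})$ and $\varrho(y)=Y$. Explicitly, it is the trivial bundle $\mathbb D\times(\mathbb C^{d_0}\oplus\dots\oplus\mathbb C^{d_m})$ on which $g\in\widetilde G$, lying above $\left(\begin{smallmatrix}a&b\\c&d\end{smallmatrix}\right)$, acts by $$(z,v)\mapsto\big(g\cdot z,\ \exp(-2l\,\varrho(h))\exp(c\,e^{-l}\,Y)\,v\big),$$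 where $l=l_g(z)$ is the continuous branch of $\log(cz+d)$ on $\mathbb D$ determined by $g$. Proposition. (i) Every elementary Hermitizable homogeneous holomorphic vector bundle over $\mathbb D$ is isomorphic to $E^{(\eta,Y)}$ for some $\eta\in\mathbb R$, some block sizes and some block lower-subdiagonal $Y$. (ii) The bundles $E^{(\eta,Y)}$ and $E^{(\eta',Y')}$ are isomorphic if and only if they have the same block sizes ($m=m'$ and $d_j=d'_j$ for all $j$), $\eta=\eta'$, and $Y'=AYA^{-1}$ for some invertible block diagonal matrix $A$ (with diagonal blocks of sizes $d_0,\dots,d_m$). -/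

import Mathlib

open scoped ComplexConjugate Manifold ContDiff Complex.UnitDisc MatrixGroups

universe u v

noncomputable section

namespace HomogeneousBundles

open Complex Bundle

/-! ### The unit disc as a complex manifold -/

/-- The inclusion of the open unit disc into the complex plane is the (global) chart. -/
lemma isOpenEmbedding_coe_disc : Topology.IsOpenEmbedding ((↑) : 𝔻 → ℂ) :=
  (Metric.isOpen_ball (x := (0 : ℂ)) (ε := 1)).isOpenEmbedding_subtypeVal

instance instChartedSpaceDisc : ChartedSpace ℂ 𝔻 :=
  isOpenEmbedding_coe_disc.singletonChartedSpace

instance instIsManifoldDisc : IsManifold 𝓘(ℂ, ℂ) ω 𝔻 :=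
  isOpenEmbedding_coe_disc.isManifold_singleton

/-! ### The group `SU(1,1)` and its action on the disc -/

/-- `SU(1,1)`: the matrices `(a, b; conj b, conj a)` of determinant one. -/
def SU11 : Subgroup SL(2, ℂ) where
  carrier := {g | g 1 1 = conj (g 0 0) ∧ g 1 0 = conj (g 0 1)}
  mul_mem' := by
    rintro g h ⟨hg, hg'⟩ ⟨hh, hh'⟩
    simp only [Set.mem_ofPred_eq, Matrix.SpecialLinearGroup.coe_mul, Matrix.mul_apply,
      Fin.sum_univ_two, map_add, map_mul, hg, hg', hh, hh', conj_conj]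
    constructor <;> ring
  one_mem' := by simp
  inv_mem' := by
    rintro g ⟨hg, hg'⟩
    constructor <;> simp [Matrix.SpecialLinearGroup.coe_inv, Matrix.adjugate_fin_two, hg, hg']

namespace SU11

/-- The entry `a` of `(a, b; c, d)`. -/
def a (g : SU11) : ℂ := g.1 0 0
/-- The entry `b` of `(a, b; c, d)`. -/
def b (g : SU11) : ℂ := g.1 0 1
/-- The entry `c` of `(a, b; c, d)`. -/
def c (g : SU11) : ℂ := g.1 1 0
/-- The entry `d` of `(a, b; c, d)`. -/
def d (g : SU11) : ℂ := g.1 1 1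

lemma d_eq (g : SU11) : d g = conj (a g) := g.2.1
lemma c_eq (g : SU11) : c g = conj (b g) := g.2.2

lemma det_eq (g : SU11) : a g * d g - b g * c g = 1 := by
  have := g.1.2
  rw [Matrix.det_fin_two] at this
  exact this

lemma ext' {g h : SU11} (ha : a g = a h) (hb : b g = b h) : g = h := by
  apply Subtype.ext
  apply Matrix.SpecialLinearGroup.ext
  intro i j
  fin_cases i <;> fin_cases j
  · exact ha
  · exact hb
  · have := (c_eq g).trans ((congrArg conj hb).trans (c_eq h).symm)
    exact this
  · have := (d_eq g).trans ((congrArg conj ha).trans (d_eq h).symm)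
    exact this

lemma a_mul (g h : SU11) : a (g * h) = a g * a h + b g * c h := by
  simp [a, b, c, Matrix.mul_apply]
lemma b_mul (g h : SU11) : b (g * h) = a g * b h + b g * d h := by
  simp [a, b, d, Matrix.mul_apply]
lemma c_mul (g h : SU11) : c (g * h) = c g * a h + d g * c h := by
  simp [a, c, d, Matrix.mul_apply]
lemma d_mul (g h : SU11) : d (g * h) = c g * b h + d g * d h := by
  simp [b, c, d, Matrix.mul_apply]
@[simp] lemma a_one : a 1 = 1 := by simp [a]
@[simp] lemma b_one : b 1 = 0 := by simp [b]
@[simp] lemma c_one : c 1 = 0 := by simp [c]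
@[simp] lemma d_one : d 1 = 1 := by simp [d]

lemma normSq_sub (g : SU11) (z : ℂ) :
    normSq (c g * z + d g) - normSq (a g * z + b g) = 1 - normSq z := by
  have h := det_eq g
  rw [c_eq, d_eq] at *
  apply Complex.ofReal_injective
  push_cast
  simp only [← Complex.mul_conj, map_add, map_mul, conj_conj]
  linear_combination (1 - z * conj z) * h

/-- The denominator `c z + d` does not vanish on the disc. -/
lemma den_ne_zero (g : SU11) (z : 𝔻) : c g * (z : ℂ) + d g ≠ 0 := by
  intro h
  have h1 := normSq_sub g z
  have h2 := z.normSq_lt_one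
  have h3 := normSq_nonneg (a g * (z : ℂ) + b g)
  rw [h, map_zero] at h1
  linarith

lemma norm_moebius_lt_one (g : SU11) (z : 𝔻) :
    ‖(a g * (z : ℂ) + b g) / (c g * z + d g)‖ < 1 := by
  have h1 := normSq_sub g z
  have h2 := z.normSq_lt_one
  rw [norm_div, div_lt_one (norm_pos_iff.2 (den_ne_zero g z))]
  rw [← abs_of_nonneg (norm_nonneg (a g * (z : ℂ) + b g)),
    ← abs_of_nonneg (norm_nonneg (c g * (z : ℂ) + d g)), ← sq_lt_sq, Complex.sq_norm,
    Complex.sq_norm]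
  linarith

/-- The action `g • z = (a z + b) / (c z + d)` of `SU(1,1)` on the unit disc. -/
instance instMulActionDisc : MulAction SU11 𝔻 where
  smul g z := UnitDisc.mk ((a g * (z : ℂ) + b g) / (c g * z + d g)) (norm_moebius_lt_one g z)
  one_smul z := by
    apply UnitDisc.coe_injective
    change (a 1 * (z : ℂ) + b 1) / (c 1 * z + d 1) = z
    simp
  mul_smul g h z := by
    apply UnitDisc.coe_injective
    change (a (g * h) * (z : ℂ) + b (g * h)) / (c (g * h) * z + d (g * h)) =
      (a g * ((a h * (z : ℂ) + b h) / (c h * z + d h)) + b g) /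
        (c g * ((a h * (z : ℂ) + b h) / (c h * z + d h)) + d g)
    have h1 := den_ne_zero h z
    rw [a_mul, b_mul, c_mul, d_mul]
    have e1 : a g * ((a h * (z : ℂ) + b h) / (c h * z + d h)) + b g =
        ((a g * a h + b g * c h) * z + (a g * b h + b g * d h)) / (c h * z + d h) := by
      rw [eq_div_iff h1]
      linear_combination a g * div_mul_cancel₀ (a h * (z : ℂ) + b h) h1
    have e2 : c g * ((a h * (z : ℂ) + b h) / (c h * z + d h)) + d g =
        ((c g * a h + d g * c h) * z + (c g * b h + d g * d h)) / (c h * z + d h) := by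
      rw [eq_div_iff h1]
      linear_combination c g * div_mul_cancel₀ (a h * (z : ℂ) + b h) h1
    rw [e1, e2, div_div_div_cancel_right₀ h1]

lemma coe_smul (g : SU11) (z : 𝔻) :
    ((g • z : 𝔻) : ℂ) = (a g * (z : ℂ) + b g) / (c g * z + d g) := rfl

lemma continuous_smul (g : SU11) : Continuous fun z : 𝔻 => g • z := by
  rw [UnitDisc.isEmbedding_coe.continuous_iff]
  change Continuous fun z : 𝔻 => (a g * (z : ℂ) + b g) / (c g * z + d g)
  exact Continuous.div (by fun_prop) (by fun_prop) (den_ne_zero g)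

end SU11

/-! ### The universal covering group of `SU(1,1)` -/

/-- The universal covering group of `SU(1,1)` (and of the Möbius group of the disc): its elements
are the pairs of `g = (a, b; c, d)` in `SU(1,1)` and a continuous branch on the disc of
`log (c z + d)`. Since `g'(z) = (c z + d)⁻²`, such a branch is the same as a branch of
`log (g'(z))`, and `g'(z) ^ s = exp (-2 s logDen g z)`. -/
@[ext] structure CoverSU11 where
  toSU11 : SU11
  logDen : 𝔻 → ℂ
  continuous_logDen : Continuous logDen
  exp_logDen : ∀ z : 𝔻, exp (logDen z) = SU11.c toSU11 * (z : ℂ) + SU11.d toSU11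

namespace CoverSU11

instance instMul : Mul CoverSU11 where
  mul g h :=
    { toSU11 := g.toSU11 * h.toSU11
      logDen := fun z => g.logDen (h.toSU11 • z) + h.logDen z
      continuous_logDen :=
        (g.continuous_logDen.comp (SU11.continuous_smul _)).add h.continuous_logDen
      exp_logDen := fun z => by
        have h1 := SU11.den_ne_zero h.toSU11 z
        rw [Complex.exp_add, g.exp_logDen, h.exp_logDen, SU11.coe_smul, SU11.c_mul, SU11.d_mul]
        linear_combination SU11.c g.toSU11 *
          div_mul_cancel₀ (SU11.a h.toSU11 * (z : ℂ) + SU11.b h.toSU11) h1 }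

instance instOne : One CoverSU11 where
  one :=
    { toSU11 := 1
      logDen := fun _ => 0
      continuous_logDen := continuous_const
      exp_logDen := fun z => by simp }

instance instInv : Inv CoverSU11 where
  inv g :=
    { toSU11 := g.toSU11⁻¹
      logDen := fun z => -g.logDen (g.toSU11⁻¹ • z)
      continuous_logDen := (g.continuous_logDen.comp (SU11.continuous_smul _)).neg
      exp_logDen := fun z => by
        have h1 := SU11.den_ne_zero g.toSU11⁻¹ z
        rw [Complex.exp_neg, g.exp_logDen, SU11.coe_smul]
        apply inv_eq_of_mul_eq_one_right
        have h2 := SU11.c_mul g.toSU11 g.toSU11⁻¹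
        have h3 := SU11.d_mul g.toSU11 g.toSU11⁻¹
        rw [mul_inv_cancel] at h2 h3
        rw [SU11.c_one] at h2
        rw [SU11.d_one] at h3
        linear_combination -(z : ℂ) * h2 - h3 + SU11.c g.toSU11 * div_mul_cancel₀
          (SU11.a g.toSU11⁻¹ * (z : ℂ) + SU11.b g.toSU11⁻¹) h1 }

@[simp] lemma toSU11_mul (g h : CoverSU11) : (g * h).toSU11 = g.toSU11 * h.toSU11 := rfl
@[simp] lemma logDen_mul (g h : CoverSU11) (z : 𝔻) :
    (g * h).logDen z = g.logDen (h.toSU11 • z) + h.logDen z := rfl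
@[simp] lemma toSU11_one : (1 : CoverSU11).toSU11 = 1 := rfl
@[simp] lemma logDen_one (z : 𝔻) : (1 : CoverSU11).logDen z = 0 := rfl
@[simp] lemma toSU11_inv (g : CoverSU11) : (g⁻¹).toSU11 = g.toSU11⁻¹ := rfl
@[simp] lemma logDen_inv (g : CoverSU11) (z : 𝔻) :
    (g⁻¹).logDen z = -g.logDen (g.toSU11⁻¹ • z) := rfl

instance instGroup : Group CoverSU11 where
  mul_assoc f g h := by
    ext1
    · simp [mul_assoc]
    · funext z; simp [mul_smul, add_assoc]
  one_mul g := by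
    ext1
    · simp
    · funext z; simp
  mul_one g := by
    ext1
    · simp
    · funext z; simp
  inv_mul_cancel g := by
    ext1
    · simp
    · funext z; simp

/-- The covering homomorphism onto `SU(1,1)`. -/
def proj : CoverSU11 →* SU11 where
  toFun := toSU11
  map_one' := rfl
  map_mul' _ _ := rfl

/-- The covering group acts on the disc through `SU(1,1)`. -/
instance instMulActionDisc : MulAction CoverSU11 𝔻 := MulAction.compHom 𝔻 proj

lemma smul_def (g : CoverSU11) (z : 𝔻) : g • z = g.toSU11 • z := rfl

/-- Two continuous branches of the same logarithm that agree at `0` agree on the disc. -/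
lemma logDen_unique {f₁ f₂ : 𝔻 → ℂ} (h₁ : Continuous f₁) (h₂ : Continuous f₂)
    (he : ∀ z, exp (f₁ z) = exp (f₂ z)) (h0 : f₁ 0 = f₂ 0) : f₁ = f₂ := by
  have : PreconnectedSpace 𝔻 :=
    Subtype.preconnectedSpace (convex_ball (0 : ℂ) 1).isPreconnected
  choose n hn using fun z => Complex.exp_eq_exp_iff_exists_int.1 (he z)
  have hpi : (2 * Real.pi * I : ℂ) ≠ 0 := Complex.two_pi_I_ne_zero
  have hcast : Continuous fun z => ((n z : ℝ)) := by
    have h : (fun z => ((n z : ℝ))) = fun z => ((f₁ z - f₂ z) / (2 * Real.pi * I)).re := by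
      funext z
      rw [hn z, add_sub_cancel_left, mul_div_cancel_right₀ _ hpi, Complex.intCast_re]
    rw [h]
    fun_prop
  have hcont : Continuous n := Int.isClosedEmbedding_coe_real.isEmbedding.continuous_iff.2 hcast
  funext z
  have h2 : n z = n 0 := PreconnectedSpace.constant ‹_› hcont
  have h3 := hn 0
  rw [h0, left_eq_add, mul_eq_zero, or_iff_left hpi, Int.cast_eq_zero] at h3
  rw [hn z, h2, h3]
  simp

/-- The value of `log d` at the point with coordinates `(b, θ)`, namely `log √(1 + |b|²) + i θ`. -/
def logD (p : ℂ × ℝ) : ℂ := ((Real.log (1 + normSq p.1) / 2 : ℝ) : ℂ) + p.2 * I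

lemma normSq_exp_logD (p : ℂ × ℝ) : normSq (exp (logD p)) = 1 + normSq p.1 := by
  have h : 0 < 1 + normSq p.1 := by have := normSq_nonneg p.1; linarith
  rw [← Complex.sq_norm, Complex.norm_exp, ← Real.exp_nat_mul]
  have : (logD p).re = Real.log (1 + normSq p.1) / 2 := by simp [logD]
  rw [this, Nat.cast_ofNat, mul_div_cancel₀ _ (two_ne_zero' ℝ), Real.exp_log h]

lemma norm_ratio_lt_one (p : ℂ × ℝ) (z : 𝔻) : ‖conj p.1 * (z : ℂ) * exp (-logD p)‖ < 1 := by
  have h := normSq_exp_logD p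
  have h0 := normSq_nonneg p.1
  have hz := z.normSq_lt_one
  rw [Complex.exp_neg, ← div_eq_mul_inv, norm_div,
    div_lt_one (norm_pos_iff.2 (Complex.exp_ne_zero _)),
    ← abs_of_nonneg (norm_nonneg (conj p.1 * (z : ℂ))),
    ← abs_of_nonneg (norm_nonneg (exp (logD p))), ← sq_lt_sq, Complex.sq_norm,
    Complex.sq_norm, h, normSq_mul, normSq_conj]
  nlinarith [normSq_nonneg (z : ℂ)]

lemma one_add_ratio_mem (p : ℂ × ℝ) (z : 𝔻) :
    1 + conj p.1 * (z : ℂ) * exp (-logD p) ∈ slitPlane :=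
  Complex.mem_slitPlane_of_norm_lt_one (norm_ratio_lt_one p z)

/-- The element of the covering group with entry `b` and with `Im (log d) = θ`. -/
def ofCoord (p : ℂ × ℝ) : CoverSU11 where
  toSU11 := ⟨⟨!![conj (exp (logD p)), p.1; conj p.1, exp (logD p)], by
      rw [Matrix.det_fin_two_of, mul_comm, Complex.mul_conj, normSq_exp_logD, Complex.mul_conj]
      push_cast
      ring⟩, by
    constructor
    · change exp (logD p) = conj (conj (exp (logD p)))
      rw [conj_conj]
    · rfl⟩
  logDen z := logD p + log (1 + conj p.1 * (z : ℂ) * exp (-logD p))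
  continuous_logDen :=
    continuous_const.add (Continuous.clog (by fun_prop) (one_add_ratio_mem p))
  exp_logDen z := by
    change _ = conj p.1 * (z : ℂ) + exp (logD p)
    rw [Complex.exp_add, Complex.exp_log (Complex.slitPlane_ne_zero (one_add_ratio_mem p z)),
      Complex.exp_neg]
    linear_combination conj p.1 * (z : ℂ) * mul_inv_cancel₀ (Complex.exp_ne_zero (logD p))

lemma logDen_zero (g : CoverSU11) : g.logDen 0 = logD (SU11.b g.toSU11, (g.logDen 0).im) := by
  have h := g.exp_logDen 0
  have h1 := SU11.det_eq g.toSU11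
  have hd : conj (SU11.a g.toSU11) = exp (g.logDen 0) := by
    rw [← SU11.d_eq, h]; simp
  have ha : SU11.a g.toSU11 = conj (exp (g.logDen 0)) := by rw [← hd, conj_conj]
  rw [SU11.c_eq, SU11.d_eq, hd, ha, mul_comm, Complex.mul_conj, Complex.mul_conj] at h1
  have h2 : normSq (exp (g.logDen 0)) = 1 + normSq (SU11.b g.toSU11) := by
    have : normSq (exp (g.logDen 0)) - normSq (SU11.b g.toSU11) = 1 := by exact_mod_cast h1
    linarith
  apply Complex.ext
  · rw [← Complex.sq_norm, Complex.norm_exp, ← Real.exp_nat_mul] at h2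
    simp [logD, ← h2]
  · simp [logD]

/-- Global real coordinates `(b, Im (log d))` on the covering group: a bijection onto `ℂ × ℝ`. In
these coordinates the covering map is `(b, θ) ↦ (a, b)` with `a = √(1 + |b|²) exp (-i θ)`. -/
def coord : CoverSU11 ≃ ℂ × ℝ where
  toFun g := (SU11.b g.toSU11, (g.logDen 0).im)
  invFun := ofCoord
  left_inv g := by
    have h0 := logDen_zero g
    set p : ℂ × ℝ := (SU11.b g.toSU11, (g.logDen 0).im) with hp
    have hm : (ofCoord p).toSU11 = g.toSU11 := by
      apply SU11.ext'
      · change conj (exp (logD p)) = _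
        rw [← h0, g.exp_logDen, SU11.d_eq]
        simp
      · rfl
    apply CoverSU11.ext hm
    apply logDen_unique (ofCoord p).continuous_logDen g.continuous_logDen
    · intro z
      rw [exp_logDen, exp_logDen, hm]
    · rw [h0]
      simp [ofCoord]
  right_inv p := by
    apply Prod.ext
    · rfl
    · simp [ofCoord, logD]

lemma logDen_eq (g : CoverSU11) (z : 𝔻) :
    g.logDen z = logD (coord g) +
      log (1 + conj (coord g).1 * (z : ℂ) * exp (-logD (coord g))) :=
  congrFun (congrArg logDen (coord.left_inv g)).symm z

/-- The topology and the real manifold structure for which `coord` is a diffeomorphism. -/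
instance instTopologicalSpace : TopologicalSpace CoverSU11 := .induced coord inferInstance

lemma isOpenEmbedding_coord : Topology.IsOpenEmbedding coord :=
  (coord.toHomeomorphOfIsInducing ⟨rfl⟩).isOpenEmbedding

instance instChartedSpace : ChartedSpace (ℂ × ℝ) CoverSU11 :=
  isOpenEmbedding_coord.singletonChartedSpace

/-- `logDen` as a function of the coordinates of the group and of the disc. -/
def logDenCoord (p : ℂ × ℝ) (z : ℂ) : ℂ :=
  logD p + log (1 + conj p.1 * z * exp (-logD p))

lemma contDiff_logD : ContDiff ℝ ∞ logD := by
  have h : ContDiff ℝ ∞ fun p : ℂ × ℝ => 1 + normSq p.1 := by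
    simp only [normSq_apply]
    have h1 : ContDiff ℝ ∞ fun p : ℂ × ℝ => p.1.re := reCLM.contDiff.comp contDiff_fst
    have h2 : ContDiff ℝ ∞ fun p : ℂ × ℝ => p.1.im := imCLM.contDiff.comp contDiff_fst
    exact contDiff_const.add ((h1.mul h1).add (h2.mul h2))
  have h' : ∀ p : ℂ × ℝ, 1 + normSq p.1 ≠ 0 := fun p => by
    have := normSq_nonneg p.1; positivity
  exact (ofRealCLM.contDiff.comp ((h.log h').div_const 2)).add
    ((ofRealCLM.contDiff.comp contDiff_snd).mul contDiff_const)

lemma contDiffAt_logDenCoord_real (p : ℂ × ℝ) (z : 𝔻) :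
    ContDiffAt ℝ ∞ (fun q : (ℂ × ℝ) × ℂ => logDenCoord q.1 q.2) (p, (z : ℂ)) := by
  have h1 : ContDiff ℝ ∞ fun q : (ℂ × ℝ) × ℂ => logD q.1 := contDiff_logD.comp contDiff_fst
  have h2 : ContDiff ℝ ∞ fun q : (ℂ × ℝ) × ℂ => conj q.1.1 :=
    conjCLE.contDiff.comp (contDiff_fst.comp contDiff_fst)
  have h3 : ContDiff ℝ ∞ fun q : (ℂ × ℝ) × ℂ => 1 + conj q.1.1 * q.2 * exp (-logD q.1) :=
    contDiff_const.add ((h2.mul contDiff_snd).mul h1.neg.cexp)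
  exact h1.contDiffAt.add (ContDiffAt.comp (g := log) (p, (z : ℂ))
    ((Complex.contDiffAt_log (one_add_ratio_mem p z)).restrict_scalars ℝ) h3.contDiffAt)

lemma contDiffAt_logDenCoord (p : ℂ × ℝ) (z : 𝔻) :
    ContDiffAt ℂ ω (logDenCoord p) (z : ℂ) := by
  have h3 : ContDiff ℂ ω fun q : ℂ => 1 + conj p.1 * q * exp (-logD p) :=
    contDiff_const.add ((contDiff_const.mul contDiff_id).mul contDiff_const)
  exact contDiffAt_const.add (ContDiffAt.comp (g := log) (z : ℂ)
    (Complex.contDiffAt_log (one_add_ratio_mem p z)) h3.contDiffAt)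

lemma contMDiff_smul (g : CoverSU11) :
    ContMDiff 𝓘(ℂ, ℂ) 𝓘(ℂ, ℂ) ω (fun z : 𝔻 => g • z) := by
  apply ContMDiff.of_comp_isOpenEmbedding isOpenEmbedding_coe_disc
  intro z
  have h : ContDiffAt ℂ ω (fun w : ℂ => (SU11.a g.toSU11 * w + SU11.b g.toSU11) /
      (SU11.c g.toSU11 * w + SU11.d g.toSU11)) (z : ℂ) :=
    ContDiffAt.div (by fun_prop) (by fun_prop) (SU11.den_ne_zero g.toSU11 z)
  exact h.comp_contMDiffAt (f := ((↑) : 𝔻 → ℂ)) (x := z)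
    (contMDiff_isOpenEmbedding isOpenEmbedding_coe_disc z)

lemma contMDiff_smul_of {EM HM M : Type*} [NormedAddCommGroup EM] [NormedSpace ℝ EM]
    [TopologicalSpace HM] {IM : ModelWithCorners ℝ EM HM} [TopologicalSpace M] [ChartedSpace HM M]
    {g : M → CoverSU11} {z : M → 𝔻}
    (h : ContMDiff IM 𝓘(ℝ, (ℂ × ℝ) × ℂ) ∞ fun x => (coord (g x), (z x : ℂ))) :
    ContMDiff IM 𝓘(ℝ, ℂ) ∞ (fun x => g x • z x) := by
  apply ContMDiff.of_comp_isOpenEmbedding isOpenEmbedding_coe_disc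
  intro x
  have hL : ContDiff ℝ ∞ fun q : (ℂ × ℝ) × ℂ => exp (logD q.1) :=
    (contDiff_logD.comp contDiff_fst).cexp
  have hb : ContDiff ℝ ∞ fun q : (ℂ × ℝ) × ℂ => q.1.1 := contDiff_fst.comp contDiff_fst
  have hd : ∀ g : CoverSU11, SU11.d g.toSU11 = exp (logD (coord g)) := fun g => by
    have h0 := g.exp_logDen 0
    rw [logDen_zero] at h0
    rw [UnitDisc.coe_zero, mul_zero, zero_add] at h0
    exact h0.symm
  have hM : ContDiffAt ℝ ∞ (fun q : (ℂ × ℝ) × ℂ => (conj (exp (logD q.1)) * q.2 + q.1.1) /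
      (conj q.1.1 * q.2 + exp (logD q.1))) (coord (g x), (z x : ℂ)) := by
    simp only [div_eq_mul_inv]
    apply ContDiffAt.mul
    · exact (((conjCLE.contDiff.comp hL).mul contDiff_snd).add hb).contDiffAt
    · apply (((conjCLE.contDiff.comp hb).mul contDiff_snd).add hL).contDiffAt.inv
      have := SU11.den_ne_zero (g x).toSU11 (z x)
      rw [SU11.c_eq, hd] at this
      exact this
  refine (hM.comp_contMDiffAt (f := fun x => (coord (g x), (z x : ℂ))) (x := x)
    (h x)).congr_of_eventuallyEq (.of_forall fun y => ?_)
  change (SU11.a (g y).toSU11 * (z y : ℂ) + SU11.b (g y).toSU11) /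
      (SU11.c (g y).toSU11 * (z y : ℂ) + SU11.d (g y).toSU11) = _
  have ha : SU11.a (g y).toSU11 = conj (exp (logD (coord (g y)))) := by
    rw [← hd, SU11.d_eq, conj_conj]
  rw [ha, SU11.c_eq, hd]
  rfl

/-- The one-parameter subgroup `t ↦ exp (i t h)`, where `h = diag (1/2, -1/2)`, of the stabilizer
of `0`; it lies above the rotation by `diag (exp (i t / 2), exp (- i t / 2))`. -/
def rot (t : ℝ) : CoverSU11 where
  toSU11 := ⟨⟨!![exp (t / 2 * I), 0; 0, exp (-(t / 2 * I))], by
      rw [Matrix.det_fin_two_of, mul_zero, sub_zero, ← Complex.exp_add, add_neg_cancel,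
        Complex.exp_zero]⟩, by
    constructor
    · change exp (-(t / 2 * I)) = conj (exp (t / 2 * I))
      rw [← Complex.exp_conj]
      congr 1
      rw [map_mul, map_div₀, conj_ofReal, conj_I, map_ofNat, mul_neg]
    · change (0 : ℂ) = conj 0
      simp⟩
  logDen := fun _ => -(t / 2 * I)
  continuous_logDen := continuous_const
  exp_logDen := fun z => by simp [SU11.c, SU11.d]

end CoverSU11

/-! ### Homogeneous holomorphic vector bundles over the disc -/

/-- A homogeneous holomorphic vector bundle over the unit disc: a holomorphic vector bundle of
finite rank (with model fibre `F`) on which the covering group acts by holomorphic bundle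
automorphisms that lie above its action on the disc. Here `act g z : E_z → E_{g z}` is the linear
map of fibres given by `g`, and the action is smooth as an action of a real Lie group. -/
structure HomogeneousBundle where
  F : Type u
  [instNormedAddCommGroup : NormedAddCommGroup F]
  [instNormedSpace : NormedSpace ℂ F]
  [instFiniteDimensional : FiniteDimensional ℂ F]
  Fiber : 𝔻 → Type u
  [instAddCommGroup : ∀ z, AddCommGroup (Fiber z)]
  [instModule : ∀ z, Module ℂ (Fiber z)]
  [instTopologicalSpaceFiber : ∀ z, TopologicalSpace (Fiber z)]
  [instTopologicalSpaceTotal : TopologicalSpace (TotalSpace F Fiber)]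
  [instFiberBundle : FiberBundle F Fiber]
  [instVectorBundle : VectorBundle ℂ F Fiber]
  [instHolomorphic : ContMDiffVectorBundle ω F Fiber 𝓘(ℂ, ℂ)]
  act : ∀ (g : CoverSU11) (z : 𝔻), Fiber z →ₗ[ℂ] Fiber (g • z)
  act_one : ∀ (z : 𝔻) (v : Fiber z),
    (⟨(1 : CoverSU11) • z, act 1 z v⟩ : TotalSpace F Fiber) = ⟨z, v⟩
  act_mul : ∀ (g h : CoverSU11) (z : 𝔻) (v : Fiber z),
    (⟨(g * h) • z, act (g * h) z v⟩ : TotalSpace F Fiber) =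
      ⟨g • h • z, act g (h • z) (act h z v)⟩
  holomorphic_act : ∀ g : CoverSU11,
    ContMDiff (𝓘(ℂ, ℂ).prod 𝓘(ℂ, F)) (𝓘(ℂ, ℂ).prod 𝓘(ℂ, F)) ω
      (fun p : TotalSpace F Fiber => (⟨g • p.1, act g p.1 p.2⟩ : TotalSpace F Fiber))
  smooth_act :
    ContMDiff (𝓘(ℝ, ℂ × ℝ).prod (𝓘(ℝ, ℂ).prod 𝓘(ℝ, F))) (𝓘(ℝ, ℂ).prod 𝓘(ℝ, F)) ∞
      (fun q : CoverSU11 × TotalSpace F Fiber =>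
        (⟨q.1 • q.2.1, act q.1 q.2.1 q.2.2⟩ : TotalSpace F Fiber))

namespace HomogeneousBundle

attribute [instance] instNormedAddCommGroup instNormedSpace instFiniteDimensional
  instAddCommGroup instModule instTopologicalSpaceFiber instTopologicalSpaceTotal
  instFiberBundle instVectorBundle instHolomorphic

/-- The total space of the bundle. -/
abbrev Total (E : HomogeneousBundle.{u}) : Type u := TotalSpace E.F E.Fiber

/-- An isomorphism of homogeneous holomorphic vector bundles: a biholomorphic map of the total
spaces which is a linear isomorphism `E_z → E'_z` on each fibre and commutes with the action. -/
structure Iso (E : HomogeneousBundle.{u}) (E' : HomogeneousBundle.{v}) where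
  fiber : ∀ z : 𝔻, E.Fiber z ≃ₗ[ℂ] E'.Fiber z
  holomorphic :
    ContMDiff (𝓘(ℂ, ℂ).prod 𝓘(ℂ, E.F)) (𝓘(ℂ, ℂ).prod 𝓘(ℂ, E'.F)) ω
      (fun p : E.Total => (⟨p.1, fiber p.1 p.2⟩ : E'.Total))
  holomorphic_symm :
    ContMDiff (𝓘(ℂ, ℂ).prod 𝓘(ℂ, E'.F)) (𝓘(ℂ, ℂ).prod 𝓘(ℂ, E.F)) ω
      (fun p : E'.Total => (⟨p.1, (fiber p.1).symm p.2⟩ : E.Total))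
  equivariant : ∀ (g : CoverSU11) (z : 𝔻) (v : E.Fiber z),
    fiber (g • z) (E.act g z v) = E'.act g z (fiber z v)

/-- `E` and `E'` are isomorphic as homogeneous holomorphic vector bundles. -/
def IsIsomorphic (E : HomogeneousBundle.{u}) (E' : HomogeneousBundle.{v}) : Prop :=
  Nonempty (Iso E E')

/-- `E` admits an invariant Hermitian structure: a smooth family of (positive definite Hermitian)
inner products on the fibres which is preserved by the action. Smoothness is expressed through the
function `v ↦ ⟨v, v⟩` on the total space. -/
def IsHermitizable (E : HomogeneousBundle.{u}) : Prop :=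
  ∃ H : ∀ z : 𝔻, E.Fiber z →ₗ⋆[ℂ] E.Fiber z →ₗ[ℂ] ℂ,
    (∀ z v w, conj (H z v w) = H z w v) ∧
    (∀ z v, v ≠ 0 → 0 < (H z v v).re) ∧
    ContMDiff (𝓘(ℝ, ℂ).prod 𝓘(ℝ, E.F)) 𝓘(ℝ, ℝ) ∞ (fun p : E.Total => (H p.1 p.2 p.2).re) ∧
    ∀ g z v w, H (g • z) (E.act g z v) (E.act g z w) = H z v w

/-- `μ` is an eigenvalue of `ϱ(h)`, where `ϱ` is the representation on the fibre `E_0` of the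
stabilizer of `0` (the group of the `rot t = exp (i t h)`): some nonzero vector `v` of `E_0`
satisfies `ϱ(exp (i t h)) v = exp (i t μ) v` for all `t`. -/
def IsIsotropyEigenvalue (E : HomogeneousBundle.{u}) (μ : ℂ) : Prop :=
  ∃ v : E.Fiber 0, v ≠ 0 ∧ ∀ t : ℝ,
    (⟨CoverSU11.rot t • (0 : 𝔻), E.act (CoverSU11.rot t) 0 v⟩ : E.Total) =
      ⟨0, exp (I * t * μ) • v⟩

/-- The eigenvalues of `ϱ(h)` form an uninterrupted string `-η, -(η + 1), …, -(η + m)`. -/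
def IsElementary (E : HomogeneousBundle.{u}) : Prop :=
  ∃ (η : ℂ) (m : ℕ), ∀ μ : ℂ, E.IsIsotropyEigenvalue μ ↔ ∃ j : ℕ, j ≤ m ∧ μ = -(η + j)

end HomogeneousBundle

/-- Regularity of maps into the total space of a trivial bundle. -/
lemma contMDiff_trivial_iff {𝕜 : Type*} [NontriviallyNormedField 𝕜] {B V EB HB EM HM M : Type*}
    [NormedAddCommGroup V] [NormedSpace 𝕜 V]
    [NormedAddCommGroup EB] [NormedSpace 𝕜 EB] [TopologicalSpace HB]
    {IB : ModelWithCorners 𝕜 EB HB} [TopologicalSpace B] [ChartedSpace HB B]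
    [NormedAddCommGroup EM] [NormedSpace 𝕜 EM] [TopologicalSpace HM]
    {IM : ModelWithCorners 𝕜 EM HM} [TopologicalSpace M] [ChartedSpace HM M] {n : ℕ∞ω}
    {f : M → TotalSpace V (Bundle.Trivial B V)} :
    ContMDiff IM (IB.prod 𝓘(𝕜, V)) n f ↔
      ContMDiff IM IB n (fun x => (f x).1) ∧
        ContMDiff IM 𝓘(𝕜, V) n (fun x => (show V from (f x).2)) := by
  simp only [ContMDiff, contMDiffAt_totalSpace, forall_and]
  rfl

/-! ### The bundle induced by a representation of `𝔟` -/

section Induced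

variable {V : Type u} [NormedAddCommGroup V] [NormedSpace ℂ V]

/-- For the holomorphic section `p(z) = (1, z; 0, 1)`, the product `p(g z)⁻¹ g p(z)` is the lower
triangular matrix `(1 / (c z + d), 0; c, c z + d) = exp (-2 l h) * exp (c exp (-l) y)`, where
`h = diag (1/2, -1/2)`, `y = (0, 0; 1, 0)` and `l` is the branch of `log (c z + d)` that belongs to
`g`. This is the value on it of the representation `ϱ` with `ϱ(h) = Z` and `ϱ(y) = Y`; it is the
inverse of the multiplier `J_g(z)`. -/
def inducedAct (Z Y : V →L[ℂ] V) (g : CoverSU11) (z : 𝔻) : V →L[ℂ] V :=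
  NormedSpace.exp (-(2 * g.logDen z) • Z) *
    NormedSpace.exp ((SU11.c g.toSU11 * exp (-g.logDen z)) • Y)

lemma inducedAct_one (Z Y : V →L[ℂ] V) (z : 𝔻) : inducedAct Z Y 1 z = 1 := by
  simp [inducedAct]

/-- The operator `inducedAct` in the coordinates of the group and of the disc. -/
def inducedActCoord (Z Y : V →L[ℂ] V) (p : ℂ × ℝ) (z : ℂ) : V →L[ℂ] V :=
  NormedSpace.exp (-(2 * CoverSU11.logDenCoord p z) • Z) *
    NormedSpace.exp ((conj p.1 * exp (-CoverSU11.logDenCoord p z)) • Y)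

lemma inducedAct_eq (Z Y : V →L[ℂ] V) (g : CoverSU11) (z : 𝔻) :
    inducedAct Z Y g z = inducedActCoord Z Y (CoverSU11.coord g) z := by
  rw [inducedAct, inducedActCoord, CoverSU11.logDen_eq, SU11.c_eq]
  rfl

variable [FiniteDimensional ℂ V]

lemma exp_mul_exp (Z Y : V →L[ℂ] V) (hZY : Z * Y - Y * Z = -Y) (s t : ℂ) :
    NormedSpace.exp (t • Y) * NormedSpace.exp (s • Z) =
      NormedSpace.exp (s • Z) * NormedSpace.exp ((t * exp s) • Y) := by
  let +nondep : NormedAlgebra ℚ (V →L[ℂ] V) := .restrictScalars ℚ ℂ (V →L[ℂ] V)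
  have : CompleteSpace V := FiniteDimensional.complete ℂ V
  have h1 : SemiconjBy Y (s • Z) (s • (Z + 1)) := by
    have : Y * Z = (Z + 1) * Y := by
      rw [add_mul, one_mul, ← sub_eq_zero]
      have := sub_eq_zero.2 hZY
      rw [← neg_eq_zero, ← this]
      abel
    simp only [SemiconjBy, mul_smul_comm, smul_mul_assoc, this]
  have h2 : NormedSpace.exp (s • (Z + 1)) = exp s • NormedSpace.exp (s • Z) := by
    rw [smul_add, NormedSpace.exp_add_of_commute
      (((Commute.one_right Z).smul_left s).smul_right s)]
    have : NormedSpace.exp (s • (1 : V →L[ℂ] V)) = exp s • 1 := by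
      rw [← Algebra.algebraMap_eq_smul_one, ← Algebra.algebraMap_eq_smul_one, 
        Complex.exp_eq_exp_ℂ, NormedSpace.algebraMap_exp_comm]
    rw [this, mul_smul_comm, mul_one]
  have h3 : SemiconjBy (NormedSpace.exp (s • Z)) ((t * exp s) • Y) (t • Y) := by
    have h4 := h1.exp_right
    rw [h2] at h4
    simp only [SemiconjBy, smul_mul_assoc, mul_smul_comm] at h4 ⊢
    rw [h4, smul_smul]
  exact h3.exp_right.symm

lemma inducedAct_mul (Z Y : V →L[ℂ] V) (hZY : Z * Y - Y * Z = -Y) (g h : CoverSU11) (z : 𝔻) :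
    inducedAct Z Y (g * h) z = inducedAct Z Y g (h • z) * inducedAct Z Y h z := by
  let +nondep : NormedAlgebra ℚ (V →L[ℂ] V) := .restrictScalars ℚ ℂ (V →L[ℂ] V)
  have : CompleteSpace V := FiniteDimensional.complete ℂ V
  have key : SU11.c (g.toSU11 * h.toSU11) * exp (-(g.logDen (h • z) + h.logDen z)) =
      SU11.c g.toSU11 * exp (-g.logDen (h • z)) * exp (-(2 * h.logDen z)) +
        SU11.c h.toSU11 * exp (-h.logDen z) := by
    have e1 := g.exp_logDen (h • z)
    have e2 := h.exp_logDen z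
    have n1 := Complex.exp_ne_zero (g.logDen (h • z))
    have n2 := Complex.exp_ne_zero (h.logDen z)
    have h1 := SU11.den_ne_zero h.toSU11 z
    have hd := SU11.det_eq h.toSU11
    have e1' : exp (g.logDen (h • z)) * exp (h.logDen z) =
        SU11.c g.toSU11 * (SU11.a h.toSU11 * (z : ℂ) + SU11.b h.toSU11) +
          SU11.d g.toSU11 * exp (h.logDen z) := by
      rw [e1, CoverSU11.smul_def, SU11.coe_smul, e2]
      linear_combination SU11.c g.toSU11 *
        div_mul_cancel₀ (SU11.a h.toSU11 * (z : ℂ) + SU11.b h.toSU11) h1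
    rw [neg_add, Complex.exp_add, two_mul, neg_add, Complex.exp_add, Complex.exp_neg,
      Complex.exp_neg, SU11.c_mul]
    generalize exp (g.logDen (h • z)) = E₁ at *
    generalize exp (h.logDen z) = E₂ at *
    field_simp
    linear_combination (-SU11.c h.toSU11) * e1' + SU11.c g.toSU11 * SU11.a h.toSU11 * e2 +
      SU11.c g.toSU11 * hd
  have hL : -(2 * (g * h).logDen z) • Z =
      -(2 * g.logDen (h • z)) • Z + -(2 * h.logDen z) • Z := by
    rw [← add_smul, CoverSU11.logDen_mul, CoverSU11.smul_def]
    congr 1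
    ring
  have hR : (SU11.c (g * h).toSU11 * exp (-(g * h).logDen z)) • Y =
      (SU11.c g.toSU11 * exp (-g.logDen (h • z)) * exp (-(2 * h.logDen z))) • Y +
        (SU11.c h.toSU11 * exp (-h.logDen z)) • Y := by
    rw [← add_smul, ← key]
    rfl
  unfold inducedAct
  rw [hL, hR, NormedSpace.exp_add_of_commute (((Commute.refl Z).smul_left _).smul_right _),
    NormedSpace.exp_add_of_commute (((Commute.refl Y).smul_left _).smul_right _)]
  have hE := exp_mul_exp Z Y hZY (-(2 * h.logDen z)) (SU11.c g.toSU11 * exp (-g.logDen (h • z)))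
  rw [mul_assoc, ← mul_assoc (NormedSpace.exp (-(2 * h.logDen z) • Z)), ← hE]
  simp only [mul_assoc]

lemma contDiffAt_exp (n : ℕ∞ω) (T : V →L[ℂ] V) :
    ContDiffAt ℂ n (NormedSpace.exp : (V →L[ℂ] V) → (V →L[ℂ] V)) T := by
  have : CompleteSpace V := FiniteDimensional.complete ℂ V
  exact (NormedSpace.exp_analytic T).contDiffAt

lemma contDiffAt_inducedActCoord_real (Z Y : V →L[ℂ] V) (p : ℂ × ℝ) (z : 𝔻) :
    ContDiffAt ℝ ∞ (fun q : (ℂ × ℝ) × ℂ => inducedActCoord Z Y q.1 q.2) (p, (z : ℂ)) := by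
  have hl := CoverSU11.contDiffAt_logDenCoord_real p z
  have hc : ContDiffAt ℝ ∞ (fun q : (ℂ × ℝ) × ℂ => conj q.1.1) (p, (z : ℂ)) :=
    (conjCLE.contDiff.comp (contDiff_fst.comp contDiff_fst)).contDiffAt
  unfold inducedActCoord
  apply ContDiffAt.mul
  · refine ContDiffAt.comp _ ((contDiffAt_exp ∞ _).restrict_scalars ℝ) ?_
    exact (contDiffAt_const.mul hl).neg.smul contDiffAt_const
  · refine ContDiffAt.comp _ ((contDiffAt_exp ∞ _).restrict_scalars ℝ) ?_
    exact (hc.mul hl.neg.cexp).smul contDiffAt_const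

lemma contDiffAt_inducedActCoord (Z Y : V →L[ℂ] V) (p : ℂ × ℝ) (z : 𝔻) :
    ContDiffAt ℂ ω (fun z : ℂ => inducedActCoord Z Y p z) (z : ℂ) := by
  have hl := CoverSU11.contDiffAt_logDenCoord p z
  unfold inducedActCoord
  apply ContDiffAt.mul
  · refine ContDiffAt.comp _ (contDiffAt_exp ω _) ?_
    exact (contDiffAt_const.mul hl).neg.smul contDiffAt_const
  · refine ContDiffAt.comp _ (contDiffAt_exp ω _) ?_
    exact (contDiffAt_const.mul hl.neg.cexp).smul contDiffAt_const

/-- The homogeneous holomorphic vector bundle holomorphically induced by the representation `ϱ` of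
`𝔟` on `V` with `ϱ(h) = Z` and `ϱ(y) = Y`, in the trivialization given by the section
`p(z) = (1, z; 0, 1)`: the trivial bundle `𝔻 × V` with the action
`(z, v) ↦ (g z, ϱ(p(g z)⁻¹ g p(z)) v)`. -/
def inducedBundle (Z Y : V →L[ℂ] V) (hZY : Z * Y - Y * Z = -Y) : HomogeneousBundle.{u} where
  F := V
  Fiber := Bundle.Trivial 𝔻 V
  act g z := (inducedAct Z Y g z).toLinearMap
  act_one z v := by
    change (⟨(1 : CoverSU11) • z, inducedAct Z Y 1 z v⟩ : TotalSpace V (Bundle.Trivial 𝔻 V)) = _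
    rw [inducedAct_one, one_smul]
    rfl
  act_mul g h z v := by
    change (⟨(g * h) • z, inducedAct Z Y (g * h) z v⟩ : TotalSpace V (Bundle.Trivial 𝔻 V)) =
      ⟨g • h • z, inducedAct Z Y g (h • z) (inducedAct Z Y h z v)⟩
    rw [inducedAct_mul Z Y hZY, mul_smul]
    rfl
  holomorphic_act g := by
    rw [contMDiff_trivial_iff]
    refine ⟨(CoverSU11.contMDiff_smul g).comp (contMDiff_proj _), fun p => ?_⟩
    have hz : ContMDiff (𝓘(ℂ, ℂ).prod 𝓘(ℂ, V)) 𝓘(ℂ, ℂ) ω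
        (fun p : TotalSpace V (Bundle.Trivial 𝔻 V) => (p.1 : ℂ)) :=
      (contMDiff_isOpenEmbedding isOpenEmbedding_coe_disc).comp (contMDiff_proj _)
    have hv := (contMDiff_trivial_iff (IM := 𝓘(ℂ, ℂ).prod 𝓘(ℂ, V)) (n := ω)
      (f := fun p : TotalSpace V (Bundle.Trivial 𝔻 V) => p)).1 contMDiff_id
    have hA := (contDiffAt_inducedActCoord Z Y (CoverSU11.coord g) p.1).comp_contMDiffAt
      (f := fun p : TotalSpace V (Bundle.Trivial 𝔻 V) => (p.1 : ℂ)) (x := p) (hz p)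
    refine (hA.clm_apply (hv.2 p)).congr_of_eventuallyEq (.of_forall fun q => ?_)
    change inducedAct Z Y g q.1 q.2 = _
    rw [inducedAct_eq]
    rfl
  smooth_act := by
    rw [contMDiff_trivial_iff]
    have hz : ContMDiff (𝓘(ℝ, ℂ × ℝ).prod (𝓘(ℝ, ℂ).prod 𝓘(ℝ, V))) 𝓘(ℝ, (ℂ × ℝ) × ℂ) ∞
        (fun q : CoverSU11 × TotalSpace V (Bundle.Trivial 𝔻 V) =>
          (CoverSU11.coord q.1, (q.2.1 : ℂ))) :=
      ((contMDiff_isOpenEmbedding CoverSU11.isOpenEmbedding_coord).comp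
        contMDiff_fst).prodMk_space
        ((contMDiff_isOpenEmbedding isOpenEmbedding_coe_disc).comp
          ((contMDiff_proj _).comp contMDiff_snd))
    refine ⟨CoverSU11.contMDiff_smul_of hz, fun p => ?_⟩
    have hv := (contMDiff_trivial_iff (IM := 𝓘(ℝ, ℂ × ℝ).prod (𝓘(ℝ, ℂ).prod 𝓘(ℝ, V))) (n := ∞)
      (f := fun q : CoverSU11 × TotalSpace V (Bundle.Trivial 𝔻 V) => q.2)).1 contMDiff_snd
    have hA := (contDiffAt_inducedActCoord_real Z Y (CoverSU11.coord p.1) p.2.1).comp_contMDiffAt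
      (f := fun q : CoverSU11 × TotalSpace V (Bundle.Trivial 𝔻 V) =>
          (CoverSU11.coord q.1, (q.2.1 : ℂ))) (x := p) (hz p)
    have hA' := ((ContinuousLinearMap.restrictScalarsL ℂ V V ℝ ℝ).contDiff
      (n := ∞)).contDiffAt.comp_contMDiffAt hA
    refine (hA'.clm_apply (hv.2 p)).congr_of_eventuallyEq (.of_forall fun q => ?_)
    change inducedAct Z Y q.1 q.2.1 q.2.2 = _
    rw [inducedAct_eq]
    rfl

end Induced

/-! ### The bundles `E^(η, Y)` -/

/-- The sizes `d_0, …, d_m` of the blocks; they are positive. -/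
structure BlockShape where
  m : ℕ
  d : Fin (m + 1) → ℕ
  d_pos : ∀ j, 0 < d j

namespace BlockShape

variable (S : BlockShape)

/-- The index set of a basis of `ℂ^(d_0) ⊕ … ⊕ ℂ^(d_m)`. -/
abbrev Index : Type := Σ j : Fin (S.m + 1), Fin (S.d j)

/-- `Y` is block lower-subdiagonal: only the blocks `Y_j` in the positions `(j, j - 1)` can be
different from zero. -/
def IsSubdiagonal (Y : Matrix S.Index S.Index ℂ) : Prop :=
  ∀ p q : S.Index, (p.1 : ℕ) ≠ (q.1 : ℕ) + 1 → Y p q = 0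

/-- `A` is block diagonal. -/
def IsBlockDiagonal (A : Matrix S.Index S.Index ℂ) : Prop :=
  ∀ p q : S.Index, p.1 ≠ q.1 → A p q = 0

/-- The matrix `ϱ(h)`, block diagonal with the blocks `-(η + j) I`. -/
def rhoH (η : ℝ) : Matrix S.Index S.Index ℂ :=
  Matrix.diagonal fun p => -((η : ℂ) + ((p.1 : ℕ) : ℂ))

/-- The operator on `ℂ^(d_0) ⊕ … ⊕ ℂ^(d_m)` given by a matrix. -/
def op (M : Matrix S.Index S.Index ℂ) : (S.Index → ℂ) →L[ℂ] (S.Index → ℂ) :=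
  LinearMap.toContinuousLinearMap (Matrix.toLin' M)

/-- The relation `[ϱ(h), ϱ(y)] = -ϱ(y)`. -/
lemma commutator (η : ℝ) {Y : Matrix S.Index S.Index ℂ} (hY : S.IsSubdiagonal Y) :
    S.op (S.rhoH η) * S.op Y - S.op Y * S.op (S.rhoH η) = -S.op Y := by
  have h : S.rhoH η * Y - Y * S.rhoH η = -Y := by
    ext p q
    simp only [rhoH, Matrix.sub_apply, Matrix.diagonal_mul, Matrix.mul_diagonal, Matrix.neg_apply]
    by_cases hpq : (p.1 : ℕ) = (q.1 : ℕ) + 1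
    · rw [hpq]
      push_cast
      ring
    · rw [hY p q hpq]
      simp
  have h2 := congrArg (fun M => Matrix.toLin' M) h
  simp only [map_sub, map_neg, Matrix.toLin'_mul] at h2
  ext1 v
  exact congrArg (fun T : (S.Index → ℂ) →ₗ[ℂ] (S.Index → ℂ) => T v) h2

/-- The homogeneous holomorphic vector bundle `E^(η, Y)`, induced by the representation with
`ϱ(h) = diag (-η I, -(η + 1) I, …, -(η + m) I)` and `ϱ(y) = Y`. -/
def bundle (η : ℝ) (Y : Matrix S.Index S.Index ℂ) (hY : S.IsSubdiagonal Y) :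
    HomogeneousBundle.{0} :=
  inducedBundle (S.op (S.rhoH η)) (S.op Y) (S.commutator η hY)

end BlockShape

end HomogeneousBundles

end

open HomogeneousBundles

noncomputable section

namespace HomogeneousBundles

open Complex Bundle

/-! ### A section of the orbit map of the origin -/

/-- The point of the disc with a given coordinate (a junk value outside of the disc). -/
def toDisc (w : ℂ) : 𝔻 := (chartAt ℂ (0 : 𝔻)).symm w

lemma toDisc_coe (z : 𝔻) : toDisc (z : ℂ) = z :=
  (chartAt ℂ (0 : 𝔻)).left_inv (x := z) (by
    change z ∈ (isOpenEmbedding_coe_disc.toOpenPartialHomeomorph _).source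
    simp)

lemma exists_coe_eq {w : ℂ} (hw : ‖w‖ < 1) : ∃ z : 𝔻, (z : ℂ) = w :=
  ⟨UnitDisc.mk w hw, rfl⟩

lemma coe_toDisc {w : ℂ} (hw : ‖w‖ < 1) : (toDisc w : ℂ) = w := by
  obtain ⟨z, rfl⟩ := exists_coe_eq hw
  rw [toDisc_coe]

@[simp] lemma toDisc_zero : toDisc 0 = 0 := by
  simpa using toDisc_coe 0

lemma chart_target : (chartAt ℂ (0 : 𝔻)).target = Metric.ball (0 : ℂ) 1 := by
  change (isOpenEmbedding_coe_disc.toOpenPartialHomeomorph _).target = _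
  rw [Topology.IsOpenEmbedding.toOpenPartialHomeomorph_target]
  ext w
  rw [mem_ball_zero_iff]
  exact ⟨fun ⟨z, hz⟩ => hz ▸ z.norm_lt_one, exists_coe_eq⟩

lemma contMDiffAt_toDisc {w : ℂ} (hw : ‖w‖ < 1) :
    ContMDiffAt 𝓘(ℂ, ℂ) 𝓘(ℂ, ℂ) ω toDisc w := by
  have h := contMDiffOn_chart_symm (I := 𝓘(ℂ, ℂ)) (n := ω) (x := (0 : 𝔻))
  rw [chart_target] at h
  exact h.contMDiffAt (Metric.isOpen_ball.mem_nhds (by simpa using hw))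

lemma eventually_norm_lt_one : ∀ᶠ w : ℂ in nhds 0, ‖w‖ < 1 := by
  filter_upwards [Metric.ball_mem_nhds (0 : ℂ) one_pos] with w hw using mem_ball_zero_iff.1 hw

namespace CoverSU11

/-- The factor `1 / √(1 - |w|²)`. -/
def secFactor (w : ℂ) : ℝ := (√(1 - normSq w))⁻¹

lemma normSq_lt_one {w : ℂ} (hw : ‖w‖ < 1) : normSq w < 1 := by
  obtain ⟨z, rfl⟩ := exists_coe_eq hw
  exact z.normSq_lt_one

/-- The positive element of the covering group which maps the origin to `w`. -/
def sec (w : ℂ) : CoverSU11 := ofCoord (w * secFactor w, 0)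

lemma coord_ofCoord (p : ℂ × ℝ) : coord (ofCoord p) = p := coord.right_inv p

lemma coord_sec (w : ℂ) : coord (sec w) = (w * secFactor w, 0) := coord_ofCoord _

lemma one_add_normSq_sec {w : ℂ} (hw : ‖w‖ < 1) :
    1 + normSq (w * secFactor w) = secFactor w ^ 2 := by
  have h := normSq_lt_one hw
  have h1 : (√(1 - normSq w)) ^ 2 = 1 - normSq w := Real.sq_sqrt (by linarith)
  rw [normSq_mul, normSq_ofReal, secFactor, ← mul_inv, ← sq, inv_pow, h1]
  have : 1 - normSq w ≠ 0 := by linarith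
  field_simp
  ring

lemma secFactor_pos {w : ℂ} (hw : ‖w‖ < 1) : 0 < secFactor w :=
  inv_pos.2 (Real.sqrt_pos.2 (by linarith [normSq_lt_one hw]))

lemma exp_logD_sec {w : ℂ} (hw : ‖w‖ < 1) :
    exp (logD (w * secFactor w, 0)) = secFactor w := by
  have h := secFactor_pos hw
  simp only [logD, one_add_normSq_sec hw, Real.log_pow]
  rw [ofReal_zero, zero_mul, add_zero, Nat.cast_ofNat, mul_div_cancel_left₀ _ two_ne_zero,
    ← ofReal_exp, Real.exp_log h]

lemma logDen_ofCoord_zero (p : ℂ × ℝ) : (ofCoord p).logDen 0 = logD p := by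
  simp [ofCoord]

lemma d_eq_exp (g : CoverSU11) : SU11.d g.toSU11 = exp (g.logDen 0) := by
  rw [g.exp_logDen]; simp

lemma sec_smul_zero {w : ℂ} (hw : ‖w‖ < 1) : sec w • (0 : 𝔻) = toDisc w := by
  apply UnitDisc.coe_injective
  rw [smul_def, SU11.coe_smul, coe_toDisc hw]
  have h : (secFactor w : ℂ) ≠ 0 := by exact_mod_cast (secFactor_pos hw).ne'
  have hd : SU11.d (sec w).toSU11 = secFactor w := by
    rw [d_eq_exp, sec, logDen_ofCoord_zero, exp_logD_sec hw]
  have hb : SU11.b (sec w).toSU11 = w * secFactor w := rfl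
  rw [hd, hb]
  simp [h]

lemma rot_smul_zero (t : ℝ) : rot t • (0 : 𝔻) = 0 := by
  apply UnitDisc.coe_injective
  rw [smul_def, SU11.coe_smul]
  simp [rot, SU11.b]

lemma coord_rot (t : ℝ) : coord (rot t) = (0, -(t / 2)) := by
  apply Prod.ext
  · rfl
  · simp [coord, rot]

lemma eq_rot_of_smul_zero {g : CoverSU11} (hg : g • (0 : 𝔻) = 0) : ∃ t : ℝ, g = rot t := by
  refine ⟨-2 * (g.logDen 0).im, coord.injective ?_⟩
  rw [coord_rot]
  have h := congrArg ((↑) : 𝔻 → ℂ) hg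
  rw [smul_def, SU11.coe_smul, div_eq_iff (SU11.den_ne_zero _ _)] at h
  apply Prod.ext
  · change SU11.b g.toSU11 = 0
    simpa using h
  · change (g.logDen 0).im = _
    ring

lemma logDen_rot (t : ℝ) (z : 𝔻) : (rot t).logDen z = -(t / 2 * I) := rfl

lemma rot_mul_sec (t : ℝ) {w : ℂ} : rot t * sec w = sec (exp (I * t) * w) * rot t := by
  have hn : normSq (exp (I * t)) = 1 := by
    rw [mul_comm, ← Complex.sq_norm, Complex.norm_exp_ofReal_mul_I, one_pow]
  have hs : secFactor (exp (I * t) * w) = secFactor w := by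
    rw [secFactor, secFactor, normSq_mul, hn, one_mul]
  apply coord.injective
  have h1 : SU11.b (sec w).toSU11 = w * secFactor w := rfl
  have h2 : SU11.b (sec (exp (I * t) * w)).toSU11 = exp (I * t) * w * secFactor w := by
    rw [← hs]; rfl
  apply Prod.ext
  · change SU11.b (rot t * sec w).toSU11 = SU11.b (sec (exp (I * t) * w) * rot t).toSU11
    rw [toSU11_mul, toSU11_mul, SU11.b_mul, SU11.b_mul, h1, h2]
    have ha : SU11.a (rot t).toSU11 = exp (t / 2 * I) := rfl
    have hb : SU11.b (rot t).toSU11 = 0 := rfl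
    have hd : SU11.d (rot t).toSU11 = exp (-(t / 2 * I)) := rfl
    have e : exp (I * t) * exp (-(t / 2 * I)) = exp (t / 2 * I) := by
      rw [← Complex.exp_add]; congr 1; ring
    rw [ha, hb, hd, ← e]
    ring
  · change ((rot t * sec w).logDen 0).im = ((sec (exp (I * t) * w) * rot t).logDen 0).im
    rw [logDen_mul, logDen_mul, ← smul_def (rot t), rot_smul_zero, logDen_rot, logDen_rot,
      sec, sec, logDen_ofCoord_zero, logDen_ofCoord_zero]
    simp [logD]

lemma c_inv (g : CoverSU11) : SU11.c (g⁻¹).toSU11 = -SU11.c g.toSU11 := by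
  simp [SU11.c, Matrix.SpecialLinearGroup.coe_inv, Matrix.adjugate_fin_two]

lemma hasFDerivAt_normSq_zero : HasFDerivAt (𝕜 := ℝ) normSq 0 (0 : ℂ) := by
  have h1 : HasFDerivAt (𝕜 := ℝ) (fun z : ℂ => z.re * z.re + z.im * z.im) _ (0 : ℂ) :=
    (reCLM.hasFDerivAt.mul reCLM.hasFDerivAt).add (imCLM.hasFDerivAt.mul imCLM.hasFDerivAt)
  refine (h1.congr_of_eventuallyEq (.of_forall normSq_apply)).congr_fderiv ?_
  ext
  · simp

lemma hasFDerivAt_secFactor : HasFDerivAt (𝕜 := ℝ) secFactor 0 (0 : ℂ) := by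
  have h1 : HasFDerivAt (𝕜 := ℝ) (fun z : ℂ => 1 - normSq z) 0 (0 : ℂ) := by
    simpa using hasFDerivAt_normSq_zero.const_sub 1
  have h2 : HasDerivAt (fun x : ℝ => (√x)⁻¹) _ (1 - normSq (0 : ℂ)) :=
    (Real.hasDerivAt_sqrt (by simp)).fun_inv (by simp)
  simpa [Function.comp_def, secFactor] using! h2.comp_hasFDerivAt (0 : ℂ) h1

@[simp] lemma secFactor_zero : secFactor 0 = 1 := by simp [secFactor]

lemma hasFDerivAt_mul_secFactor :
    HasFDerivAt (𝕜 := ℝ) (fun w : ℂ => w * (secFactor w : ℂ)) (ContinuousLinearMap.id ℝ ℂ) 0 := by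
  have h1 : HasFDerivAt (𝕜 := ℝ) (fun w : ℂ => (secFactor w : ℂ)) (0 : ℂ →L[ℝ] ℂ) (0 : ℂ) := by
    simpa [Function.comp_def] using ofRealCLM.hasFDerivAt.comp (0 : ℂ) hasFDerivAt_secFactor
  simpa using (hasFDerivAt_id (𝕜 := ℝ) (0 : ℂ)).fun_mul h1

lemma hasFDerivAt_logD_sec :
    HasFDerivAt (𝕜 := ℝ) (fun w : ℂ => logD (w * (secFactor w : ℂ), 0)) 0 0 := by
  have h0 : HasFDerivAt (𝕜 := ℝ) normSq 0 ((0 : ℂ) * (secFactor 0 : ℂ)) := by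
    simpa using hasFDerivAt_normSq_zero
  have h1 : HasFDerivAt (𝕜 := ℝ) (fun w : ℂ => normSq (w * (secFactor w : ℂ))) 0 (0 : ℂ) := by
    simpa [Function.comp_def] using
      HasFDerivAt.comp (0 : ℂ) h0 hasFDerivAt_mul_secFactor
  have h2 := ((h1.const_add 1).log (by simp)).mul_const (1 / 2 : ℝ)
  have h3 := (ofRealCLM.hasFDerivAt.comp (0 : ℂ) h2)
  simpa [Function.comp_def, logD, div_eq_mul_inv, -map_mul] using h3

end CoverSU11

open CoverSU11

section Multiplier

variable {V : Type*} [NormedAddCommGroup V] [NormedSpace ℂ V]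

lemma inducedAct_sec_inv (Z Y : V →L[ℂ] V) {w : ℂ} (hw : ‖w‖ < 1) :
    inducedAct Z Y (sec w)⁻¹ (toDisc w) =
      NormedSpace.exp ((2 * logD (w * secFactor w, 0)) • Z) *
        NormedSpace.exp ((-(conj (w * (secFactor w : ℂ)) *
          exp (logD (w * secFactor w, 0)))) • Y) := by
  have h : (sec w)⁻¹.logDen (toDisc w) = -logD (w * secFactor w, 0) := by
    rw [logDen_inv, ← toSU11_inv, ← smul_def, ← sec_smul_zero hw, inv_smul_smul]
    congr 1
    exact logDen_ofCoord_zero _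
  have hc : SU11.c (sec w)⁻¹.toSU11 = -conj (w * (secFactor w : ℂ)) := by
    rw [c_inv, SU11.c_eq]; rfl
  rw [inducedAct, h, hc]
  congr 3 <;> ring_nf

variable [FiniteDimensional ℂ V]

omit [FiniteDimensional ℂ V] in
lemma inducedAct_rot (Z Y : V →L[ℂ] V) (t : ℝ) (z : 𝔻) :
    inducedAct Z Y (rot t) z = NormedSpace.exp ((I * t) • Z) := by
  have hc : SU11.c (rot t).toSU11 = 0 := rfl
  rw [inducedAct, hc, logDen_rot, zero_mul, zero_smul, NormedSpace.exp_zero, mul_one]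
  congr 2
  ring

lemma inducedAct_inv_mul (Z Y : V →L[ℂ] V) (hZY : Z * Y - Y * Z = -Y) (g : CoverSU11) (z : 𝔻) :
    inducedAct Z Y g⁻¹ (g • z) * inducedAct Z Y g z = 1 := by
  rw [← inducedAct_mul Z Y hZY, inv_mul_cancel, inducedAct_one]

lemma inducedAct_mul_inv (Z Y : V →L[ℂ] V) (hZY : Z * Y - Y * Z = -Y) (g : CoverSU11) (z : 𝔻) :
    inducedAct Z Y g z * inducedAct Z Y g⁻¹ (g • z) = 1 := by
  have := inducedAct_inv_mul Z Y hZY g⁻¹ (g • z)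
  rwa [inv_inv, inv_smul_smul] at this

lemma hasFDerivAt_exp_smul (Y : V →L[ℂ] V) {f : ℂ → ℂ} {f' : ℂ →L[ℝ] ℂ}
    (hf : HasFDerivAt f f' 0) (h0 : f 0 = 0) :
    HasFDerivAt (fun w => NormedSpace.exp (f w • Y)) (f'.smulRight Y) 0 := by
  have : CompleteSpace V := FiniteDimensional.complete ℂ V
  have h1 : HasFDerivAt (fun w => f w • Y) (f'.smulRight Y) 0 := hf.smul_const Y
  have h2 : HasFDerivAt (NormedSpace.exp : (V →L[ℂ] V) → (V →L[ℂ] V))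
      (1 : (V →L[ℂ] V) →L[ℂ] (V →L[ℂ] V)) (f 0 • Y) := by
    rw [h0, zero_smul]
    exact hasFDerivAt_exp_zero
  exact HasFDerivAt.comp (0 : ℂ) (h2.restrictScalars ℝ) h1

/-- The derivative at the origin of `w ↦ J(g_w⁻¹, w)` for `g_w = sec w`. -/
lemma hasFDerivAt_inducedAct_sec_inv (Z Y : V →L[ℂ] V) :
    HasFDerivAt (𝕜 := ℝ) (fun w => inducedAct Z Y (sec w)⁻¹ (toDisc w))
      ((-(conjCLE : ℂ →L[ℝ] ℂ)).smulRight Y) 0 := by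
  have hc : HasFDerivAt (𝕜 := ℝ) (fun w : ℂ => conj (w * (secFactor w : ℂ)))
      (conjCLE : ℂ →L[ℝ] ℂ) 0 :=
    (conjCLE : ℂ →L[ℝ] ℂ).hasFDerivAt.comp (0 : ℂ) hasFDerivAt_mul_secFactor
  have hl := hasFDerivAt_logD_sec
  have hl0 : logD ((0 : ℂ) * (secFactor 0 : ℂ), 0) = 0 := by simp [logD]
  have e1 : HasFDerivAt (𝕜 := ℝ) (fun w : ℂ => 2 * logD (w * (secFactor w : ℂ), 0)) 0 0 := by
    simpa using hl.const_mul (2 : ℂ)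
  have e2 : HasFDerivAt (𝕜 := ℝ) (fun w : ℂ => -(conj (w * (secFactor w : ℂ)) *
      exp (logD (w * (secFactor w : ℂ), 0)))) (-(conjCLE : ℂ →L[ℝ] ℂ)) 0 := by
    refine (hc.fun_mul hl.cexp).fun_neg.congr_fderiv ?_
    rw [hl0, Complex.exp_zero, smul_zero, smul_zero, zero_add, one_smul]
  have h1 := hasFDerivAt_exp_smul Z e1 (by rw [hl0, mul_zero])
  have h2 := hasFDerivAt_exp_smul Y e2 (by rw [zero_mul, map_zero, zero_mul, neg_zero])
  refine ((h1.mul' h2).congr_of_eventuallyEq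
    (eventually_norm_lt_one.mono fun w hw => inducedAct_sec_inv Z Y hw)).congr_fderiv ?_
  refine ContinuousLinearMap.ext fun w => ?_
  rw [hl0, mul_zero, zero_smul, NormedSpace.exp_zero]
  change (1 : V →L[ℂ] V) * (-conj w) • Y + ((0 : ℂ) • Z) * _ = (-conj w) • Y
  rw [one_mul, zero_smul, zero_mul, add_zero]

end Multiplier

/-! ### Isomorphisms of induced bundles -/

section Intertwiner

variable {V : Type u} [NormedAddCommGroup V] [NormedSpace ℂ V] [FiniteDimensional ℂ V]
  {V' : Type v} [NormedAddCommGroup V'] [NormedSpace ℂ V'] [FiniteDimensional ℂ V']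

lemma hasDerivAt_exp_rot (Z : V →L[ℂ] V) :
    HasDerivAt (fun t : ℝ => NormedSpace.exp ((I * (t : ℂ)) • Z)) (I • Z) 0 := by
  have : CompleteSpace V := FiniteDimensional.complete ℂ V
  have h2 : HasFDerivAt (NormedSpace.exp : (V →L[ℂ] V) → (V →L[ℂ] V))
      (1 : (V →L[ℂ] V) →L[ℂ] (V →L[ℂ] V)) ((I * ((0 : ℝ) : ℂ)) • Z) := by
    rw [ofReal_zero, mul_zero, zero_smul]
    exact hasFDerivAt_exp_zero
  have h1 : HasDerivAt (fun t : ℝ => (I * (t : ℂ)) • Z) (I • Z) 0 := by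
    have : HasDerivAt (fun t : ℝ => I * (t : ℂ)) I 0 := by
      simpa using (hasDerivAt_id (0 : ℝ)).ofReal_comp.const_mul I
    exact this.smul_const Z
  exact (h2.restrictScalars ℝ).comp_hasDerivAt (0 : ℝ) h1

lemma hasDerivAt_exp_rot_apply (Z : V →L[ℂ] V) (v : V) :
    HasDerivAt (fun t : ℝ => NormedSpace.exp ((I * (t : ℂ)) • Z) v) (I • Z v) 0 :=
  ((ContinuousLinearMap.apply ℂ V v).restrictScalars ℝ).hasFDerivAt.comp_hasDerivAt (0 : ℝ)
    (hasDerivAt_exp_rot Z)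

omit [FiniteDimensional ℂ V] in
lemma inducedAct_sec_zero (Z Y : V →L[ℂ] V) : inducedAct Z Y (sec 0)⁻¹ 0 = 1 := by
  rw [← toDisc_zero, inducedAct_sec_inv Z Y (by simp)]
  simp [logD]

lemma hasFDerivAt_inducedAct_sec_inv_apply (Z Y : V →L[ℂ] V) {f : ℂ → V} {L : ℂ →L[ℝ] V}
    (hf : HasFDerivAt f L 0) :
    HasFDerivAt (fun w => inducedAct Z Y (sec w)⁻¹ (toDisc w) (f w))
      (L - (conjCLE : ℂ →L[ℝ] ℂ).smulRight (Y (f 0))) 0 := by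
  have h1 := (ContinuousLinearMap.restrictScalarsL ℂ V V ℝ ℝ).hasFDerivAt.comp (0 : ℂ)
    (hasFDerivAt_inducedAct_sec_inv Z Y)
  refine (h1.clm_apply hf).congr_fderiv (ContinuousLinearMap.ext fun w => ?_)
  change inducedAct Z Y (sec 0)⁻¹ (toDisc 0) (L w) + (-conj w) • Y (f 0) = L w - conj w • Y (f 0)
  rw [toDisc_zero, inducedAct_sec_zero, neg_smul, sub_eq_add_neg]
  rfl

lemma semiconjBy_inducedAct {A Z Y Z' Y' : V →L[ℂ] V} (hZ : SemiconjBy A Z Z')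
    (hY : SemiconjBy A Y Y') (g : CoverSU11) (z : 𝔻) :
    SemiconjBy A (inducedAct Z Y g z) (inducedAct Z' Y' g z) := by
  let +nondep : NormedAlgebra ℚ (V →L[ℂ] V) := .restrictScalars ℚ ℂ (V →L[ℂ] V)
  have : CompleteSpace V := FiniteDimensional.complete ℂ V
  have h : ∀ {T T' : V →L[ℂ] V} (s : ℂ), SemiconjBy A T T' → SemiconjBy A (s • T) (s • T') := by
    intro T T' s hT
    rw [SemiconjBy, mul_smul_comm, hT.eq, smul_mul_assoc]
  exact (h _ hZ).exp_right.mul_right (h _ hY).exp_right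

lemma Iso.exists_intertwiner {Z Y : V →L[ℂ] V} {Z' Y' : V' →L[ℂ] V'}
    (hZY : Z * Y - Y * Z = -Y) (hZY' : Z' * Y' - Y' * Z' = -Y')
    (Φ : HomogeneousBundle.Iso (inducedBundle Z Y hZY) (inducedBundle Z' Y' hZY')) :
    ∃ A : V ≃ₗ[ℂ] V', (∀ v, A (Z v) = Z' (A v)) ∧ ∀ v, A (Y v) = Y' (A v) := by
  let φ : 𝔻 → V ≃ₗ[ℂ] V' := Φ.fiber
  have heq : ∀ g z v, φ (g • z) (inducedAct Z Y g z v) = inducedAct Z' Y' g z (φ z v) :=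
    Φ.equivariant
  let A : V →L[ℂ] V' := LinearMap.toContinuousLinearMap (φ 0).toLinearMap
  have hA : ∀ v, A v = φ 0 v := fun v => rfl
  refine ⟨φ 0, fun v => ?_, fun v => ?_⟩
  · have h1 : HasDerivAt (fun t : ℝ => A (NormedSpace.exp ((I * (t : ℂ)) • Z) v))
        (A (I • Z v)) 0 :=
      (A.restrictScalars ℝ).hasFDerivAt.comp_hasDerivAt (0 : ℝ) (hasDerivAt_exp_rot_apply Z v)
    have h3 : (fun t : ℝ => A (NormedSpace.exp ((I * (t : ℂ)) • Z) v)) =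
        fun t : ℝ => NormedSpace.exp ((I * (t : ℂ)) • Z') (A v) := by
      funext t
      have := heq (rot t) 0 v
      rwa [inducedAct_rot, inducedAct_rot, rot_smul_zero] at this
    rw [h3] at h1
    have h4 := h1.unique (hasDerivAt_exp_rot_apply Z' (A v))
    rw [map_smul] at h4
    exact smul_right_injective V' I_ne_zero h4
  · have hd : DifferentiableAt ℂ (fun w => φ (toDisc w) v) 0 := by
      have h1 := ((contMDiff_trivial_iff (V := V')).1 Φ.holomorphic).2
      have h2 : ContMDiffAt 𝓘(ℂ, ℂ) (𝓘(ℂ, ℂ).prod 𝓘(ℂ, V)) ω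
          (fun w : ℂ => (⟨toDisc w, v⟩ : TotalSpace V (Bundle.Trivial 𝔻 V))) 0 := by
        rw [contMDiffAt_totalSpace]
        exact ⟨contMDiffAt_toDisc (by simp), contMDiffAt_const⟩
      have h3 : ContMDiffAt 𝓘(ℂ, ℂ) 𝓘(ℂ, V') ω (fun w : ℂ => φ (toDisc w) v) 0 :=
        ContMDiffAt.comp (0 : ℂ) (h1 _) h2
      exact h3.contDiffAt.differentiableAt (by simp)
    have hL := hd.hasFDerivAt.restrictScalars ℝ
    have h1 := hasFDerivAt_inducedAct_sec_inv_apply Z' Y' hL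
    have h2 := (A.restrictScalars ℝ).hasFDerivAt.comp (0 : ℂ)
      (hasFDerivAt_inducedAct_sec_inv_apply Z Y (hasFDerivAt_const (𝕜 := ℝ) v (0 : ℂ)))
    have h3 : (fun w => inducedAct Z' Y' (sec w)⁻¹ (toDisc w) (φ (toDisc w) v)) =ᶠ[nhds 0]
        fun w => A (inducedAct Z Y (sec w)⁻¹ (toDisc w) v) := by
      filter_upwards [eventually_norm_lt_one] with w hw
      have h := heq (sec w)⁻¹ (toDisc w) v
      rw [← h, ← sec_smul_zero hw, inv_smul_smul, hA]
    have h4 := h1.unique (h2.congr_of_eventuallyEq h3)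
    have h5 : fderiv ℂ (fun w => φ (toDisc w) v) 0 1 - conj (1 : ℂ) • Y' (φ (toDisc 0) v) =
        A (0 - conj (1 : ℂ) • Y v) := congrArg (fun L : ℂ →L[ℝ] V' => L 1) h4
    have h6 : fderiv ℂ (fun w => φ (toDisc w) v) 0 I - conj I • Y' (φ (toDisc 0) v) =
        A (0 - conj I • Y v) := congrArg (fun L : ℂ →L[ℝ] V' => L I) h4
    have h7 : fderiv ℂ (fun w => φ (toDisc w) v) 0 I =
        I • fderiv ℂ (fun w => φ (toDisc w) v) 0 1 := by
      rw [← map_smul, smul_eq_mul, mul_one]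
    rw [toDisc_zero, map_one (starRingEnd ℂ), one_smul, one_smul, zero_sub, map_neg, sub_eq_iff_eq_add] at h5
    rw [h7, h5, toDisc_zero, zero_sub, map_neg, conj_I, map_smul] at h6
    rw [← hA, ← hA]
    rw [← hA] at h6
    have h8 : (2 * I) • (Y' (A v) - A (Y v)) = 0 := by
      rw [← sub_eq_zero] at h6
      rw [← h6]
      module
    rw [smul_eq_zero, or_iff_right (by simp), sub_eq_zero] at h8
    exact h8.symm

end Intertwiner

lemma prod_X_sub_C_roots {ι : Type*} [Fintype ι] (f : ι → ℂ) :
    (∏ i, (Polynomial.X - Polynomial.C (f i))).roots = Finset.univ.val.map f := by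
  have h := Polynomial.roots_multiset_prod_X_sub_C (Finset.univ.val.map f)
  rwa [Multiset.map_map] at h

/-- Intertwined diagonal operators have the same eigenvalues with the same multiplicities. -/
lemma card_eq_of_diagonal_intertwiner {ι ι' : Type*} [Fintype ι] [DecidableEq ι] [Fintype ι']
    [DecidableEq ι'] (f : ι → ℂ) (f' : ι' → ℂ) (A : (ι → ℂ) ≃ₗ[ℂ] (ι' → ℂ))
    (hA : ∀ v, A (Matrix.toLin' (Matrix.diagonal f) v) = Matrix.toLin' (Matrix.diagonal f') (A v))
    (μ : ℂ) : Fintype.card {i // f i = μ} = Fintype.card {i // f' i = μ} := by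
  have h1 : A.conj (Matrix.toLin' (Matrix.diagonal f)) = Matrix.toLin' (Matrix.diagonal f') := by
    refine LinearMap.ext fun v => ?_
    rw [LinearEquiv.conj_apply_apply, hA, LinearEquiv.apply_symm_apply]
  have h2 := LinearEquiv.charpoly_conj A (Matrix.toLin' (Matrix.diagonal f))
  rw [h1, Matrix.charpoly_toLin', Matrix.charpoly_toLin', Matrix.charpoly_diagonal,
    Matrix.charpoly_diagonal] at h2
  have h3 := congrArg (fun p => p.roots.count μ) h2
  simp only [prod_X_sub_C_roots, Multiset.count_map] at h3
  rw [Fintype.card_subtype, Fintype.card_subtype]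
  simp only [eq_comm (b := μ)]
  exact h3.symm

namespace BlockShape

lemma card_weight (S : BlockShape) (η : ℝ) (j : Fin (S.m + 1)) :
    Fintype.card {p : S.Index // -((η : ℂ) + ((p.1 : ℕ) : ℂ)) = -((η : ℂ) + ((j : ℕ) : ℂ))} =
      S.d j := by
  rw [← Fintype.card_fin (S.d j)]
  refine Fintype.card_congr ((Equiv.subtypeEquivRight fun p => ?_).trans (Equiv.sigmaSubtype j))
  rw [neg_inj, add_right_inj, Nat.cast_inj, Fin.val_inj]

/-- The multiplicities of the weights determine the block sizes and the parameter. -/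
lemma eq_of_card_weight {S S' : BlockShape} {η η' : ℝ}
    (h : ∀ μ : ℂ, Fintype.card {p : S.Index // -((η : ℂ) + ((p.1 : ℕ) : ℂ)) = μ} =
      Fintype.card {p : S'.Index // -((η' : ℂ) + ((p.1 : ℕ) : ℂ)) = μ}) : η = η' ∧ S = S' := by
  have key : ∀ {S S' : BlockShape} {η η' : ℝ}
      (h : ∀ μ : ℂ, Fintype.card {p : S.Index // -((η : ℂ) + ((p.1 : ℕ) : ℂ)) = μ} =
        Fintype.card {p : S'.Index // -((η' : ℂ) + ((p.1 : ℕ) : ℂ)) = μ}) (j : Fin (S.m + 1)),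
      ∃ j' : Fin (S'.m + 1), η + (j : ℕ) = η' + (j' : ℕ) := by
    intro S S' η η' h j
    have h1 := h (-((η : ℂ) + ((j : ℕ) : ℂ)))
    rw [card_weight] at h1
    have h2 := S.d_pos j
    rw [h1, Fintype.card_pos_iff] at h2
    obtain ⟨p, hp⟩ := h2
    refine ⟨p.1, ?_⟩
    have h3 := neg_injective hp
    exact_mod_cast h3.symm
  have hη : η = η' := by
    obtain ⟨j, hj⟩ := key h 0
    obtain ⟨j', hj'⟩ := key (fun μ => (h μ).symm) 0
    simp only [Fin.val_zero, Nat.cast_zero, add_zero] at hj hj'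
    have h1 : (0 : ℝ) ≤ (j : ℕ) := Nat.cast_nonneg _
    have h2 : (0 : ℝ) ≤ (j' : ℕ) := Nat.cast_nonneg _
    linarith
  subst hη
  have hm : S.m = S'.m := by
    obtain ⟨j, hj⟩ := key h (Fin.last _)
    obtain ⟨j', hj'⟩ := key (fun μ => (h μ).symm) (Fin.last _)
    have h1 : S.m = (j : ℕ) := by exact_mod_cast add_left_cancel hj
    have h2 : S'.m = (j' : ℕ) := by exact_mod_cast add_left_cancel hj'
    have := j.2
    have := j'.2
    omega
  refine ⟨rfl, ?_⟩
  have hd : ∀ (j : Fin (S.m + 1)) (j' : Fin (S'.m + 1)), (j : ℕ) = j' → S.d j = S'.d j' := by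
    intro j j' hj
    rw [← card_weight S η j, ← card_weight S' η j', h, hj]
  obtain ⟨m, d, hd0⟩ := S
  obtain ⟨m', d', hd0'⟩ := S'
  obtain rfl : m = m' := hm
  obtain rfl : d = d' := funext fun j => hd j j rfl
  rfl

lemma op_mul (S : BlockShape) (M N : Matrix S.Index S.Index ℂ) :
    S.op (M * N) = S.op M * S.op N := by
  refine ContinuousLinearMap.ext fun v => ?_
  exact congrArg (fun T => T v) (Matrix.toLin'_mul M N)

lemma op_rhoH (S : BlockShape) (η : ℝ) (v : S.Index → ℂ) (p : S.Index) :
    S.op (S.rhoH η) v p = -((η : ℂ) + ((p.1 : ℕ) : ℂ)) * v p := by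
  change (S.rhoH η).mulVec v p = _
  rw [rhoH, Matrix.mulVec_diagonal]

lemma eq_of_isIsomorphic {S S' : BlockShape} {η η' : ℝ} {Y : Matrix S.Index S.Index ℂ}
    {Y' : Matrix S'.Index S'.Index ℂ} {hY : S.IsSubdiagonal Y} {hY' : S'.IsSubdiagonal Y'}
    (h : (S.bundle η Y hY).IsIsomorphic (S'.bundle η' Y' hY')) : η = η' ∧ S = S' := by
  obtain ⟨Φ⟩ := h
  obtain ⟨A, hA, -⟩ := Iso.exists_intertwiner _ _ Φ
  exact eq_of_card_weight (card_eq_of_diagonal_intertwiner _ _ A hA)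

lemma isIsomorphic_iff (S : BlockShape) (η η' : ℝ) (Y Y' : Matrix S.Index S.Index ℂ)
    (hY : S.IsSubdiagonal Y) (hY' : S.IsSubdiagonal Y') :
    (S.bundle η Y hY).IsIsomorphic (S.bundle η' Y' hY') ↔
      η = η' ∧ ∃ A : Matrix S.Index S.Index ℂ,
        IsUnit A ∧ S.IsBlockDiagonal A ∧ Y' = A * Y * A⁻¹ := by
  constructor
  · intro h
    obtain rfl := (eq_of_isIsomorphic h).1
    obtain ⟨Φ⟩ := h
    obtain ⟨A, hA, hA'⟩ := Iso.exists_intertwiner _ _ Φ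
    set B := LinearMap.toMatrix' A.toLinearMap with hB
    have hBA : Matrix.toLin' B = A.toLinearMap := Matrix.toLin'_toMatrix' _
    have hBY : B * Y = Y' * B := by
      apply Matrix.toLin'.injective
      rw [Matrix.toLin'_mul, Matrix.toLin'_mul, hBA]
      exact LinearMap.ext hA'
    have hBZ : B * S.rhoH η = S.rhoH η * B := by
      apply Matrix.toLin'.injective
      rw [Matrix.toLin'_mul, Matrix.toLin'_mul, hBA]
      exact LinearMap.ext hA
    have hu : IsUnit B := by
      refine IsUnit.of_mul_eq_one (LinearMap.toMatrix' A.symm.toLinearMap) ?_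
      rw [hB, ← LinearMap.toMatrix'_comp]
      simp
    refine ⟨rfl, B, hu, fun p q hpq => ?_, ?_⟩
    · have h1 := congrFun (congrFun hBZ p) q
      rw [rhoH, Matrix.mul_diagonal, Matrix.diagonal_mul, ← sub_eq_zero] at h1
      have h2 : B p q * (((p.1 : ℕ) : ℂ) - ((q.1 : ℕ) : ℂ)) = 0 := by
        rw [← h1]; ring
      refine (mul_eq_zero.1 h2).resolve_right fun h3 => hpq ?_
      exact Fin.ext (by exact_mod_cast sub_eq_zero.1 h3)
    · rw [hBY, Matrix.mul_nonsing_inv_cancel_right _ _ ((Matrix.isUnit_iff_isUnit_det B).1 hu)]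
  · rintro ⟨rfl, A, hu, hAd, rfl⟩
    have hdet := (Matrix.isUnit_iff_isUnit_det A).1 hu
    have hZ : SemiconjBy (S.op A) (S.op (S.rhoH η)) (S.op (S.rhoH η)) := by
      have h : A * S.rhoH η = S.rhoH η * A := by
        ext p q
        rw [rhoH, Matrix.mul_diagonal, Matrix.diagonal_mul]
        by_cases hpq : p.1 = q.1
        · rw [hpq, mul_comm]
        · rw [hAd p q hpq, mul_zero, zero_mul]
      rw [SemiconjBy, ← op_mul, h, op_mul]
    have hYA : SemiconjBy (S.op A) (S.op Y) (S.op (A * Y * A⁻¹)) := by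
      rw [SemiconjBy, ← op_mul, ← op_mul, Matrix.nonsing_inv_mul_cancel_right _ _ hdet]
    let e : (S.Index → ℂ) ≃L[ℂ] (S.Index → ℂ) :=
      (Matrix.toLinearEquiv' A (A.invertibleOfIsUnitDet hdet)).toContinuousLinearEquiv
    have he : ∀ v, e v = S.op A v := fun v => rfl
    refine ⟨⟨fun _ => e.toLinearEquiv, ?_, ?_, fun g z v => ?_⟩⟩
    · refine (contMDiff_trivial_iff (V := S.Index → ℂ)).2 ⟨contMDiff_proj _, ?_⟩
      exact (e.contDiff (n := ω)).contMDiff.comp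
        ((contMDiff_trivial_iff (V := S.Index → ℂ)).1 contMDiff_id).2
    · refine (contMDiff_trivial_iff (V := S.Index → ℂ)).2 ⟨contMDiff_proj _, ?_⟩
      exact (e.symm.contDiff (n := ω)).contMDiff.comp
        ((contMDiff_trivial_iff (V := S.Index → ℂ)).1 contMDiff_id).2
    · have hsc : SemiconjBy (S.op A) (inducedAct (S.op (S.rhoH η)) (S.op Y) g z)
          (inducedAct (S.op (S.rhoH η)) (S.op (A * Y * A⁻¹)) g z) :=
        semiconjBy_inducedAct hZ hYA g z
      exact congrArg (fun T : (S.Index → ℂ) →L[ℂ] (S.Index → ℂ) => T v) hsc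

end BlockShape

/-! ### One-parameter groups preserving an inner product -/

section OneParameter

/-- An operator that is symmetric for a positive definite Hermitian form is diagonalizable with
real eigenvalues. -/
lemma diagonalizable_of_symmetric {V : Type*} [AddCommGroup V] [Module ℂ V] [FiniteDimensional ℂ V]
    (H : V →ₗ⋆[ℂ] V →ₗ[ℂ] ℂ) (hH : ∀ v w, conj (H v w) = H w v)
    (hpos : ∀ v, v ≠ 0 → 0 < (H v v).re) (Z : V →ₗ[ℂ] V) (hZ : ∀ v w, H (Z v) w = H v (Z w)) :
    (⨆ μ, Module.End.eigenspace Z μ) = ⊤ ∧ ∀ μ, Module.End.HasEigenvalue Z μ → conj μ = μ := by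
  let core : InnerProductSpace.Core ℂ V :=
    { inner := fun v w => H v w
      conj_inner_symm := fun v w => hH w v
      re_inner_nonneg := fun v => by
        by_cases hv : v = 0
        · simp [hv]
        · exact (hpos v hv).le
      add_left := fun v w x => by simp
      smul_left := fun v w r => by simp
      definite := fun v hv => by
        by_contra h
        have := hpos v h
        rw [show H v v = 0 from hv] at this
        simp at this }
  let _ : NormedAddCommGroup V := core.toNormedAddCommGroup
  let _ : InnerProductSpace ℂ V := .ofCore core.toCore
  have hS : Z.IsSymmetric := hZ
  exact ⟨Submodule.orthogonal_eq_bot_iff.1 hS.orthogonalComplement_iSup_eigenspaces_eq_bot,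
    fun μ hμ => hS.conj_eigenvalue_eq_self hμ⟩

variable {V : Type*} [NormedAddCommGroup V] [NormedSpace ℂ V] [FiniteDimensional ℂ V]

/-- The generator of a differentiable one-parameter group of linear operators, with a factor
`-i`. -/
lemma exists_generator (U : ℝ → V →ₗ[ℂ] V) (hU0 : U 0 = LinearMap.id)
    (hU : ∀ s t, U (s + t) = U s ∘ₗ U t) (hd : ∀ v, DifferentiableAt ℝ (fun t => U t v) 0) :
    ∃ Z : V →ₗ[ℂ] V, (∀ v, HasDerivAt (fun t => U t v) (I • Z v) 0) ∧
      ∀ v μ, Z v = μ • v ↔ ∀ t : ℝ, U t v = exp (I * t * μ) • v := by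
  let T : V →ₗ[ℂ] V :=
    { toFun := fun v => deriv (fun t => U t v) 0
      map_add' := fun v w => by
        simp only [map_add]
        exact deriv_fun_add (hd v) (hd w)
      map_smul' := fun c v => by
        simp only [map_smul, RingHom.id_apply]
        exact deriv_fun_const_smul c (hd v) }
  have hT : ∀ v, HasDerivAt (fun t => U t v) (T v) 0 := fun v => (hd v).hasDerivAt
  have hIT : ∀ v, I • (-I) • T v = T v := fun v => by rw [smul_smul]; simp
  have hexp : ∀ (μ : ℂ) (t : ℝ), HasDerivAt (fun t : ℝ => exp (I * t * μ))
      (exp (I * t * μ) * (I * μ)) t := fun μ t => by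
    have h1 : HasDerivAt (fun t : ℝ => I * (t : ℂ) * μ) (I * μ) t := by
      simpa using ((hasDerivAt_id t).ofReal_comp.const_mul I).mul_const μ
    exact h1.cexp
  refine ⟨(-I) • T, fun v => ?_, fun v μ => ⟨fun h => ?_, fun h => ?_⟩⟩
  · rw [LinearMap.smul_apply, hIT]
    exact hT v
  · have hTv : T v = (I * μ) • v := by
      rw [← hIT, mul_smul, ← h, LinearMap.smul_apply]
    have hUt : ∀ t, HasDerivAt (fun t => U t v) ((I * μ) • U t v) t := fun t => by
      have h1 : HasDerivAt (fun s => U s v) (T v) (t - t) := by rw [sub_self]; exact hT v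
      have h2 : HasDerivAt (fun s => U (s - t) v) (T v) t := h1.comp_sub_const t t
      have h3 := ((LinearMap.toContinuousLinearMap (U t)).restrictScalars
        ℝ).hasFDerivAt.comp_hasDerivAt t h2
      have h4 : (fun s => U s v) = fun s => U t (U (s - t) v) := by
        funext s
        rw [← LinearMap.comp_apply, ← hU, add_sub_cancel]
      rw [h4, ← map_smul, ← hTv]
      exact h3
    have hconst : ∀ t, HasDerivAt (fun t : ℝ => exp (I * t * (-μ)) • U t v) 0 t := fun t => by
      refine ((hexp (-μ) t).smul (hUt t)).congr_deriv ?_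
      module
    intro t
    have h5 := is_const_of_deriv_eq_zero (fun t => (hconst t).differentiableAt)
      (fun t => (hconst t).deriv) t 0
    simp only [ofReal_zero, mul_zero, zero_mul, Complex.exp_zero, one_smul, hU0,
      LinearMap.id_apply] at h5
    conv_rhs => rw [← h5]
    rw [smul_smul, ← Complex.exp_add]
    simp
  · have h1 : HasDerivAt (fun t => U t v) ((I * μ) • v) 0 := by
      simp only [h]
      simpa using (hexp μ 0).smul_const v
    have h2 := (hT v).unique h1
    rw [LinearMap.smul_apply, h2, smul_smul]
    congr 1
    linear_combination -μ * I_mul_I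

/-- The generator of a one-parameter group which preserves a Hermitian form. -/
lemma symmetric_of_generator (U : ℝ → V →ₗ[ℂ] V) (hU0 : U 0 = LinearMap.id)
    (hU : ∀ s t, U (s + t) = U s ∘ₗ U t) {Z : V →ₗ[ℂ] V}
    (hZ : ∀ v, HasDerivAt (fun t => U t v) (I • Z v) 0)
    (H : V →ₗ⋆[ℂ] V →ₗ[ℂ] ℂ) (hH : ∀ v w, conj (H v w) = H w v)
    (hinv : ∀ t v w, H (U t v) (U t w) = H v w) (v w : V) : H (Z v) w = H v (Z w) := by
  have hL : ∀ x y, HasDerivAt (fun t => H x (U t y)) (H x (I • Z y)) 0 := fun x y =>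
    ((LinearMap.toContinuousLinearMap (H x)).restrictScalars ℝ).hasFDerivAt.comp_hasDerivAt 0 (hZ y)
  have h1 : HasDerivAt (fun t => conj (H w (U t v))) (conj (H w (I • Z v))) 0 :=
    (conjCLE : ℂ →L[ℝ] ℂ).hasFDerivAt.comp_hasDerivAt 0 (hL w v)
  have h2 : HasDerivAt (fun t => H v (U (-t) w)) (-(H v (I • Z w))) 0 := by
    have h3 : HasDerivAt (fun t => H v (U t w)) (H v (I • Z w)) (-0) := by
      rw [neg_zero]; exact hL v w
    simpa [Function.comp_def] using h3.scomp (0 : ℝ) (hasDerivAt_neg 0)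
  have h4 : (fun t => conj (H w (U t v))) = fun t => H v (U (-t) w) := by
    funext t
    rw [hH, ← hinv (-t) (U t v) w, ← LinearMap.comp_apply (U (-t)), ← hU, neg_add_cancel, hU0,
      LinearMap.id_apply]
  rw [h4] at h1
  have h5 := h1.unique h2
  rw [hH, map_smulₛₗ, LinearMap.smul_apply, conj_I, map_smul, smul_eq_mul, smul_eq_mul, neg_mul,
    neg_inj] at h5
  exact mul_left_cancel₀ I_ne_zero h5

/-- A diagonalizable operator whose eigenvalues form a string has a basis of eigenvectors indexed
by blocks. -/
lemma exists_basis_of_string {V : Type*} [AddCommGroup V] [Module ℂ V] [FiniteDimensional ℂ V]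
    (Z : V →ₗ[ℂ] V) (htop : (⨆ μ, Module.End.eigenspace Z μ) = ⊤) (η : ℝ) (m : ℕ)
    (hm : ∀ μ, Module.End.HasEigenvalue Z μ ↔ ∃ j : ℕ, j ≤ m ∧ μ = -((η : ℂ) + j)) :
    ∃ (S : BlockShape) (b : Module.Basis S.Index ℂ V),
      ∀ p, Z (b p) = (-((η : ℂ) + ((p.1 : ℕ) : ℂ))) • b p := by
  let W : Fin (m + 1) → Submodule ℂ V := fun j => Module.End.eigenspace Z (-((η : ℂ) + (j : ℕ)))
  have hinj : Function.Injective fun j : Fin (m + 1) => -((η : ℂ) + ((j : ℕ) : ℂ)) := by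
    intro i j hij
    exact Fin.ext (by exact_mod_cast add_left_cancel (neg_injective hij))
  have hind : iSupIndep W := (Module.End.eigenspaces_iSupIndep Z).comp hinj
  have hsup : ⨆ j, W j = ⊤ := by
    rw [eq_top_iff, ← htop]
    refine iSup_le fun μ => ?_
    by_cases h : Module.End.HasEigenvalue Z μ
    · obtain ⟨j, hj, rfl⟩ := (hm μ).1 h
      exact le_iSup W ⟨j, Nat.lt_succ_of_le hj⟩
    · rw [Module.End.hasEigenvalue_iff, not_not] at h
      rw [h]
      exact bot_le
  have hint := DirectSum.isInternal_submodule_of_iSupIndep_of_iSup_eq_top hind hsup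
  let S : BlockShape :=
    { m := m
      d := fun j => Module.finrank ℂ (W j)
      d_pos := fun j => by
        have h : Module.End.HasEigenvalue Z (-((η : ℂ) + (j : ℕ))) :=
          (hm _).2 ⟨j, Nat.le_of_lt_succ j.2, rfl⟩
        exact Module.finrank_pos_iff.2 (Submodule.nontrivial_iff_ne_bot.2 h) }
  refine ⟨S, hint.collectedBasis fun j => Module.finBasis ℂ (W j), fun p => ?_⟩
  exact Module.End.mem_eigenspace_iff.1 (hint.collectedBasis_mem _ p)

lemma exp_apply_of_eigenvector {T : V →L[ℂ] V} {v : V} {μ : ℂ} (h : T v = μ • v) :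
    NormedSpace.exp T v = exp μ • v := by
  have : CompleteSpace V := FiniteDimensional.complete ℂ V
  have hpow : ∀ n : ℕ, (T ^ n) v = μ ^ n • v := fun n => by
    induction n with
    | zero => simp
    | succ n ih =>
      rw [pow_succ, mul_apply_eq_comp, h, map_smul, ih, smul_smul, pow_succ, mul_comm]
  have h1 := (NormedSpace.exp_series_hasSum_exp' (𝕂 := ℂ) T).mapL
    (ContinuousLinearMap.apply ℂ V v)
  have h2 := ((NormedSpace.exp_series_hasSum_exp' (𝕂 := ℂ) μ).smul_const v)
  rw [← Complex.exp_eq_exp_ℂ] at h2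
  simp only [map_smul, ContinuousLinearMap.apply_apply, hpow] at h1
  simp only [smul_assoc] at h2
  exact h1.unique h2

lemma BlockShape.exp_rhoH_single (S : BlockShape) (η t : ℝ) (p : S.Index) :
    NormedSpace.exp ((I * (t : ℂ)) • S.op (S.rhoH η)) (Pi.single p 1) =
      exp (I * t * -((η : ℂ) + ((p.1 : ℕ) : ℂ))) • (Pi.single p 1 : S.Index → ℂ) := by
  refine exp_apply_of_eigenvector (funext fun q => ?_)
  rw [smul_apply, Pi.smul_apply, S.op_rhoH, Pi.smul_apply]
  by_cases hq : q = p
  · subst hq; simp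
  · simp [hq]

end OneParameter

/-! ### The representation on the fibre over the origin -/

namespace HomogeneousBundle

variable (E : HomogeneousBundle.{u})

/-- The map of fibres given by `g`, as a map into a fibre whose base point is only known to be
equal to `g • z`. -/
def actTo (g : CoverSU11) {z w : 𝔻} (h : g • z = w) : E.Fiber z →ₗ[ℂ] E.Fiber w :=
  h ▸ E.act g z

lemma mk_actTo (g : CoverSU11) {z w : 𝔻} (h : g • z = w) (v : E.Fiber z) :
    (⟨w, E.actTo g h v⟩ : E.Total) = ⟨g • z, E.act g z v⟩ := by
  subst h; rfl

lemma actTo_rfl (g : CoverSU11) (z : 𝔻) : E.actTo g (rfl : g • z = g • z) = E.act g z := rfl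

lemma actTo_actTo {g g' : CoverSU11} {z w w' : 𝔻} (h : g • z = w) (h' : g' • w = w')
    (v : E.Fiber z) :
    E.actTo g' h' (E.actTo g h v) = E.actTo (g' * g) (by rw [mul_smul, h, h']) v := by
  subst h h'
  apply TotalSpace.mk_injective
  rw [mk_actTo, mk_actTo, E.act_mul, actTo_rfl]

lemma actTo_one {z : 𝔻} (h : (1 : CoverSU11) • z = z) (v : E.Fiber z) : E.actTo 1 h v = v := by
  apply TotalSpace.mk_injective
  rw [mk_actTo, E.act_one]

lemma actTo_congr {g g' : CoverSU11} (hg : g = g') {z w : 𝔻} (h : g • z = w) (v : E.Fiber z) :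
    E.actTo g h v = E.actTo g' (hg ▸ h) v := by
  subst hg; rfl

/-- `actTo` as an isomorphism of fibres. -/
def actEquiv (g : CoverSU11) {z w : 𝔻} (h : g • z = w) : E.Fiber z ≃ₗ[ℂ] E.Fiber w :=
  { E.actTo g h with
    invFun := E.actTo g⁻¹ (by rw [← h, inv_smul_smul])
    left_inv := fun v => by
      change E.actTo g⁻¹ _ (E.actTo g h v) = v
      rw [actTo_actTo, E.actTo_congr (inv_mul_cancel g), actTo_one]
    right_inv := fun v => by
      change E.actTo g _ (E.actTo g⁻¹ _ v) = v
      rw [actTo_actTo, E.actTo_congr (mul_inv_cancel g), actTo_one] }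

/-- The trivialization near the origin. -/
abbrev triv : Trivialization E.F (TotalSpace.proj : E.Total → 𝔻) :=
  trivializationAt E.F E.Fiber 0

lemma zero_mem_triv : (0 : 𝔻) ∈ E.triv.baseSet := FiberBundle.mem_baseSet_trivializationAt' 0

/-- The fibre over the origin in the trivialization. -/
def fiberZero : E.Fiber 0 ≃ₗ[ℂ] E.F := E.triv.linearEquivAt ℂ 0 E.zero_mem_triv

lemma fiberZero_apply (v : E.Fiber 0) : E.fiberZero v = (E.triv ⟨0, v⟩).2 := rfl

lemma contMDiff_ofCoord : ContMDiff 𝓘(ℝ, ℂ × ℝ) 𝓘(ℝ, ℂ × ℝ) ∞ ofCoord := by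
  apply ContMDiff.of_comp_isOpenEmbedding isOpenEmbedding_coord
  have : coord ∘ ofCoord = id := funext coord_ofCoord
  rw [this]
  exact contMDiff_id

lemma contMDiff_orbit (u : E.Fiber 0) :
    ContMDiff 𝓘(ℝ, ℂ × ℝ) (𝓘(ℝ, ℂ).prod 𝓘(ℝ, E.F)) ∞
      (fun p : ℂ × ℝ => (⟨ofCoord p • (0 : 𝔻), E.act (ofCoord p) 0 u⟩ : E.Total)) := by
  have h : ContMDiff 𝓘(ℝ, ℂ × ℝ) (𝓘(ℝ, ℂ × ℝ).prod (𝓘(ℝ, ℂ).prod 𝓘(ℝ, E.F))) ∞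
      (fun p : ℂ × ℝ => (ofCoord p, (⟨0, u⟩ : E.Total))) :=
    contMDiff_ofCoord.prodMk contMDiff_const
  have h' := ContMDiff.comp E.smooth_act h
  exact h'

/-- The orbit map of a vector over the origin is smooth in the trivialization. -/
lemma contDiffAt_orbit (u : E.Fiber 0) {p : ℂ × ℝ} (hp : ofCoord p • (0 : 𝔻) = 0) :
    ContDiffAt ℝ ∞
      (fun p : ℂ × ℝ => (E.triv ⟨ofCoord p • 0, E.act (ofCoord p) 0 u⟩).2) p := by
  have h := (contMDiffAt_totalSpace.1 (E.contMDiff_orbit u p)).2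
  dsimp only at h
  rw [hp] at h
  exact h.contDiffAt

lemma ofCoord_rot (t : ℝ) : ofCoord (0, -(t / 2)) = rot t := by
  rw [← coord_rot]; exact coord.symm_apply_apply _

/-- The representation of the rotations on the fibre over the origin. -/
def isotropy (t : ℝ) : E.F →ₗ[ℂ] E.F := E.fiberZero.conj (E.actTo (rot t) (rot_smul_zero t))

lemma isotropy_fiberZero (t : ℝ) (u : E.Fiber 0) :
    E.isotropy t (E.fiberZero u) = E.fiberZero (E.actTo (rot t) (rot_smul_zero t) u) := by
  rw [isotropy, LinearEquiv.conj_apply_apply, LinearEquiv.symm_apply_apply]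

lemma rot_add (s t : ℝ) : rot (s + t) = rot s * rot t := by
  apply coord.injective
  rw [coord_rot]
  apply Prod.ext
  · change (0 : ℂ) = SU11.b (rot s * rot t).toSU11
    rw [toSU11_mul, SU11.b_mul]
    simp [rot, SU11.b]
  · change _ = ((rot s * rot t).logDen 0).im
    rw [logDen_mul, logDen_rot, logDen_rot]
    simp
    ring

lemma rot_zero : rot 0 = 1 := by
  apply coord.injective
  rw [coord_rot]
  simp [coord]

lemma isotropy_zero : E.isotropy 0 = LinearMap.id := by
  refine LinearMap.ext fun v => ?_
  obtain ⟨u, rfl⟩ := E.fiberZero.surjective v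
  rw [isotropy_fiberZero, E.actTo_congr rot_zero, actTo_one, LinearMap.id_apply]

lemma isotropy_add (s t : ℝ) : E.isotropy (s + t) = E.isotropy s ∘ₗ E.isotropy t := by
  refine LinearMap.ext fun v => ?_
  obtain ⟨u, rfl⟩ := E.fiberZero.surjective v
  rw [LinearMap.comp_apply, isotropy_fiberZero, isotropy_fiberZero, isotropy_fiberZero,
    actTo_actTo, E.actTo_congr (rot_add s t)]

lemma differentiableAt_isotropy (v : E.F) : DifferentiableAt ℝ (fun t => E.isotropy t v) 0 := by
  obtain ⟨u, rfl⟩ := E.fiberZero.surjective v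
  have h0 : ofCoord (0, -((0 : ℝ) / 2)) • (0 : 𝔻) = 0 := by rw [ofCoord_rot, rot_smul_zero]
  have h1 := (E.contDiffAt_orbit u h0).differentiableAt (by simp)
  have h2 : DifferentiableAt ℝ (fun t : ℝ => ((0 : ℂ), -(t / 2))) 0 := by fun_prop
  have h3 := DifferentiableAt.comp (0 : ℝ) h1 h2
  refine h3.congr_of_eventuallyEq (.of_forall fun t => ?_)
  dsimp only [Function.comp_apply]
  rw [isotropy_fiberZero, fiberZero_apply, mk_actTo, ofCoord_rot]

lemma isIsotropyEigenvalue_iff (μ : ℂ) : E.IsIsotropyEigenvalue μ ↔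
    ∃ v : E.F, v ≠ 0 ∧ ∀ t : ℝ, E.isotropy t v = exp (I * t * μ) • v := by
  have key : ∀ u : E.Fiber 0, ∀ t : ℝ,
      (⟨CoverSU11.rot t • (0 : 𝔻), E.act (CoverSU11.rot t) 0 u⟩ : E.Total) =
        ⟨0, exp (I * t * μ) • u⟩ ↔
      E.isotropy t (E.fiberZero u) = exp (I * t * μ) • E.fiberZero u := fun u t => by
    rw [← E.mk_actTo _ (rot_smul_zero t), isotropy_fiberZero, ← map_smul,
      E.fiberZero.injective.eq_iff]
    exact (TotalSpace.mk_injective (0 : 𝔻)).eq_iff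
  constructor
  · rintro ⟨u, hu, h⟩
    exact ⟨E.fiberZero u, by simpa using hu, fun t => (key u t).1 (h t)⟩
  · rintro ⟨v, hv, h⟩
    obtain ⟨u, rfl⟩ := E.fiberZero.surjective v
    exact ⟨u, by simpa using hv, fun t => (key u t).2 (h t)⟩

/-- The fibre over the origin of an elementary Hermitizable bundle as a representation of the
stabilizer. -/
lemma exists_weight_coordinates (hH : E.IsHermitizable) (hE : E.IsElementary) :
    ∃ (η : ℝ) (S : BlockShape) (κ : (S.Index → ℂ) ≃ₗ[ℂ] E.Fiber 0), ∀ (t : ℝ) (v : S.Index → ℂ),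
      E.actTo (rot t) (rot_smul_zero t) (κ v) =
        κ (NormedSpace.exp ((I * (t : ℂ)) • S.op (S.rhoH η)) v) := by
  obtain ⟨H, hsymm, hpos, -, hinv⟩ := hH
  obtain ⟨η, m, hm⟩ := hE
  obtain ⟨Z, hZ, hZe⟩ := exists_generator E.isotropy E.isotropy_zero E.isotropy_add
    E.differentiableAt_isotropy
  have hinv' : ∀ (t : ℝ) (v w : E.Fiber 0), H 0 (E.actTo (rot t) (rot_smul_zero t) v)
      (E.actTo (rot t) (rot_smul_zero t) w) = H 0 v w := by
    intro t v w
    have : ∀ {z : 𝔻} (h : rot t • (0 : 𝔻) = z), H z (E.actTo (rot t) h v) (E.actTo (rot t) h w) =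
        H 0 v w := by
      rintro z rfl
      exact hinv _ _ _ _
    exact this _
  let H' : E.F →ₗ⋆[ℂ] E.F →ₗ[ℂ] ℂ :=
    LinearMap.mk₂'ₛₗ (starRingEnd ℂ) (RingHom.id ℂ)
      (fun v w => H 0 (E.fiberZero.symm v) (E.fiberZero.symm w))
      (fun _ _ _ => by simp) (fun _ _ _ => by simp) (fun _ _ _ => by simp) (fun _ _ _ => by simp)
  have hH' : ∀ v w, H' v w = H 0 (E.fiberZero.symm v) (E.fiberZero.symm w) := fun _ _ => rfl
  have hH's : ∀ v w, conj (H' v w) = H' w v := fun v w => hsymm _ _ _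
  have hsym := symmetric_of_generator E.isotropy E.isotropy_zero E.isotropy_add hZ H' hH's
    (fun t v w => by
      rw [hH', hH', isotropy, LinearEquiv.conj_apply_apply, LinearEquiv.conj_apply_apply,
        LinearEquiv.symm_apply_apply, LinearEquiv.symm_apply_apply, hinv'])
  obtain ⟨htop, hreal⟩ := diagonalizable_of_symmetric H' hH's
    (fun v hv => hpos _ _ (by simpa using hv)) Z hsym
  have hm' : ∀ μ, Module.End.HasEigenvalue Z μ ↔ ∃ j : ℕ, j ≤ m ∧ μ = -(η + j) := by
    intro μ
    rw [← hm, isIsotropyEigenvalue_iff]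
    constructor
    · intro h
      obtain ⟨v, hv, hv0⟩ := h.exists_hasEigenvector
      exact ⟨v, hv0, (hZe v μ).1 (Module.End.mem_eigenspace_iff.1 hv)⟩
    · rintro ⟨v, hv0, hv⟩
      exact Module.End.hasEigenvalue_of_hasEigenvector
        ⟨Module.End.mem_eigenspace_iff.2 ((hZe v μ).2 hv), hv0⟩
  have hη : conj η = η := by
    have := hreal _ ((hm' _).2 ⟨0, m.zero_le, rfl⟩)
    simpa using this
  obtain ⟨r, rfl⟩ := conj_eq_iff_real.1 hη
  obtain ⟨S, b, hb⟩ := exists_basis_of_string Z htop r m hm'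
  refine ⟨r, S, b.equivFun.symm.trans E.fiberZero.symm, fun t v => ?_⟩
  apply E.fiberZero.injective
  rw [← isotropy_fiberZero, LinearEquiv.trans_apply, LinearEquiv.trans_apply,
    LinearEquiv.apply_symm_apply, LinearEquiv.apply_symm_apply]
  let f : (S.Index → ℂ) →ₗ[ℂ] E.F := E.isotropy t ∘ₗ b.equivFun.symm.toLinearMap
  let g : (S.Index → ℂ) →ₗ[ℂ] E.F := b.equivFun.symm.toLinearMap ∘ₗ
    (NormedSpace.exp ((I * (t : ℂ)) • S.op (S.rhoH r))).toLinearMap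
  suffices h : f = g from congrArg (fun f => f v) h
  refine (Pi.basisFun ℂ S.Index).ext fun p => ?_
  have h1 : (b.equivFun.symm (Pi.single p 1)) = b p := by simp
  rw [Pi.basisFun_apply]
  change E.isotropy t (b.equivFun.symm (Pi.single p 1)) =
    b.equivFun.symm (NormedSpace.exp ((I * (t : ℂ)) • S.op (S.rhoH r)) (Pi.single p 1))
  rw [S.exp_rhoH_single, map_smul, h1]
  exact (hZe _ _).1 (hb p) t

end HomogeneousBundle

/-! ### Families of operators and conjugate linear parts of derivatives -/

section OperatorFamilies

variable {V : Type*} [NormedAddCommGroup V] [NormedSpace ℂ V] [FiniteDimensional ℂ V]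
  {F : Type*} [NormedAddCommGroup F] [NormedSpace ℂ F]

lemma clm_eq_sum (A : V →L[ℂ] F) :
    A = ∑ i, ContinuousLinearMap.smulRightL ℂ V F
      (LinearMap.toContinuousLinearMap ((Module.finBasis ℂ V).coord i))
      (A (Module.finBasis ℂ V i)) := by
  refine ContinuousLinearMap.ext fun v => ?_
  rw [sum_apply]
  conv_lhs => rw [← (Module.finBasis ℂ V).sum_repr v, map_sum]
  exact Finset.sum_congr rfl fun i _ => map_smul A _ _

lemma contDiffAt_of_apply {A : ℂ → V →L[ℂ] F} {x : ℂ} {n : ℕ∞ω}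
    (h : ∀ v, ContDiffAt ℂ n (fun w => A w v) x) : ContDiffAt ℂ n A x := by
  have hA : A = _ := funext fun w => clm_eq_sum (A w)
  rw [hA]
  exact ContDiffAt.sum fun i _ => (ContinuousLinearMap.contDiff _).contDiffAt.comp x (h _)

lemma differentiableAt_of_apply {A : ℂ → V →L[ℂ] F} {x : ℂ}
    (h : ∀ v, DifferentiableAt ℂ (fun w => A w v) x) : DifferentiableAt ℂ A x := by
  have hA : A = _ := funext fun w => clm_eq_sum (A w)
  rw [hA]
  exact DifferentiableAt.fun_sum fun i _ =>
    (ContinuousLinearMap.differentiableAt _).comp x (h _)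

lemma differentiableAt_real_of_apply {A : ℂ → V →L[ℂ] F} {x : ℂ}
    (h : ∀ v, DifferentiableAt ℝ (fun w => A w v) x) : DifferentiableAt ℝ A x := by
  have hA : A = _ := funext fun w => clm_eq_sum (A w)
  rw [hA]
  refine DifferentiableAt.fun_sum fun i _ => ?_
  let L : F →L[ℂ] (V →L[ℂ] F) := ContinuousLinearMap.smulRightL ℂ V F
    (LinearMap.toContinuousLinearMap ((Module.finBasis ℂ V).coord i))
  exact ((L.restrictScalars ℝ).differentiableAt).comp x (h _)

/-- `f` is real differentiable at the origin, and its derivative is the sum of a complex linear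
map and of `w ↦ conj w • q`. -/
def HasConjDerivAt (f : ℂ → F) (q : F) : Prop :=
  ∃ P : ℂ →L[ℂ] F, HasFDerivAt (𝕜 := ℝ) f
    (P.restrictScalars ℝ + (conjCLE : ℂ →L[ℝ] ℂ).smulRight q) 0

lemma HasConjDerivAt.of_differentiableAt {f : ℂ → F} (hf : DifferentiableAt ℂ f 0) :
    HasConjDerivAt f 0 := by
  refine ⟨fderiv ℂ f 0, (hf.hasFDerivAt.restrictScalars ℝ).congr_fderiv ?_⟩
  refine ContinuousLinearMap.ext fun w => ?_
  change _ = _ + conj w • (0 : F)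
  rw [smul_zero, add_zero]
  rfl

lemma HasConjDerivAt.differentiableAt {f : ℂ → F} (hf : HasConjDerivAt f 0) :
    DifferentiableAt ℂ f 0 := by
  obtain ⟨P, hP⟩ := hf
  have h : P.restrictScalars ℝ = P.restrictScalars ℝ + (conjCLE : ℂ →L[ℝ] ℂ).smulRight 0 := by
    refine ContinuousLinearMap.ext fun w => ?_
    change _ = _ + conj w • (0 : F)
    rw [smul_zero, add_zero]
    rfl
  exact (hasFDerivAt_of_restrictScalars ℝ hP h).differentiableAt

lemma HasConjDerivAt.congr {f f' : ℂ → F} {q : F} (hf : HasConjDerivAt f q)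
    (h : f' =ᶠ[nhds 0] f) : HasConjDerivAt f' q := by
  obtain ⟨P, hP⟩ := hf
  exact ⟨P, hP.congr_of_eventuallyEq h⟩

/-- The conjugate linear part of a real linear map. -/
lemma conj_part_eq {L : ℂ →L[ℝ] F} {P : ℂ →L[ℂ] F} {q : F}
    (h : L = P.restrictScalars ℝ + (conjCLE : ℂ →L[ℝ] ℂ).smulRight q) :
    q = (2 : ℂ)⁻¹ • (L 1 + I • L I) := by
  have h1 : L 1 = P 1 + conj (1 : ℂ) • q := by rw [h]; rfl
  have h2 : L I = P I + conj I • q := by rw [h]; rfl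
  have h3 : P I = I • P 1 := by rw [← map_smul, smul_eq_mul, mul_one]
  rw [h1, h2, h3, map_one (starRingEnd ℂ), conj_I]
  match_scalars
  · linear_combination (1 / 2) * I_mul_I
  · linear_combination (-1 / 2) * I_mul_I

lemma eq_complex_add_conj (L : ℂ →L[ℝ] F) :
    ∃ P : ℂ →L[ℂ] F, L = P.restrictScalars ℝ +
      (conjCLE : ℂ →L[ℝ] ℂ).smulRight ((2 : ℂ)⁻¹ • (L 1 + I • L I)) := by
  refine ⟨(1 : ℂ →L[ℂ] ℂ).smulRight ((2 : ℂ)⁻¹ • (L 1 - I • L I)), ?_⟩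
  refine ContinuousLinearMap.ext fun w => ?_
  change L w = w • (2 : ℂ)⁻¹ • (L 1 - I • L I) + conj w • (2 : ℂ)⁻¹ • (L 1 + I • L I)
  have h1 : L w = w.re • L 1 + w.im • L I := by
    rw [← map_smul, ← map_smul, ← map_add]
    congr 1
    apply Complex.ext <;> simp
  have h2 : w = w.re + w.im * I := (re_add_im w).symm
  have h3 : conj w = w.re - w.im * I := by
    apply Complex.ext <;> simp
  rw [h1, h3]
  nth_rewrite 3 [h2]
  rw [← Complex.coe_smul, ← Complex.coe_smul]
  match_scalars
  · ring
  · linear_combination (w.im : ℂ) * I_mul_I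

lemma HasConjDerivAt.unique {f : ℂ → F} {q q' : F} (h : HasConjDerivAt f q)
    (h' : HasConjDerivAt f q') : q = q' := by
  obtain ⟨P, hP⟩ := h
  obtain ⟨P', hP'⟩ := h'
  rw [conj_part_eq (L := fderiv ℝ f 0) hP.fderiv, conj_part_eq (L := fderiv ℝ f 0) hP'.fderiv]

lemma HasConjDerivAt.exists_of_differentiableAt {f : ℂ → F} (h : DifferentiableAt ℝ f 0) :
    HasConjDerivAt f ((2 : ℂ)⁻¹ • (fderiv ℝ f 0 1 + I • fderiv ℝ f 0 I)) := by
  obtain ⟨P, hP⟩ := eq_complex_add_conj (fderiv ℝ f 0)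
  exact ⟨P, h.hasFDerivAt.congr_fderiv hP⟩

/-- The product rule for the conjugate linear part of the derivative. -/
lemma HasConjDerivAt.clm_apply {A : ℂ → V →L[ℂ] F} {N : ℂ → V} {q : F} {r : V}
    (hA : ∀ v, DifferentiableAt ℝ (fun w => A w v) 0)
    (hq : HasConjDerivAt (fun w => A w (N 0)) q) (hN : HasConjDerivAt N r) :
    HasConjDerivAt (fun w => A w (N w)) (q + A 0 r) := by
  obtain ⟨P, hP⟩ := hq
  obtain ⟨P', hP'⟩ := hN
  have hd := (differentiableAt_real_of_apply hA).hasFDerivAt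
  have h1 := (ContinuousLinearMap.restrictScalarsL ℂ V F ℝ ℝ).hasFDerivAt.comp (0 : ℂ) hd
  have h2 := h1.clm_apply hP'
  have h3 := (((ContinuousLinearMap.apply ℂ F (N 0)).restrictScalars ℝ).hasFDerivAt.comp
    (0 : ℂ) hd).unique hP
  refine ⟨P + (A 0).comp P', h2.congr_fderiv (ContinuousLinearMap.ext fun w => ?_)⟩
  have h4 : (fderiv ℝ A 0 w) (N 0) = P w + conj w • q :=
    congrArg (fun L : ℂ →L[ℝ] F => L w) h3
  change A 0 (P' w + conj w • r) + (fderiv ℝ A 0 w) (N 0) =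
    P w + A 0 (P' w) + conj w • (q + A 0 r)
  rw [h4, map_add, map_smul, smul_add]
  abel

/-- The conjugate linear parts of the derivatives of the values of a family of operators. -/
lemma exists_conj_part {A : ℂ → V →L[ℂ] F} (hA : ∀ v, DifferentiableAt ℝ (fun w => A w v) 0) :
    ∃ Q : V →L[ℂ] F, ∀ v, HasConjDerivAt (fun w => A w v) (Q v) := by
  refine ⟨(2 : ℂ)⁻¹ • (fderiv ℝ A 0 1 + I • fderiv ℝ A 0 I), fun v => ?_⟩
  have h := HasConjDerivAt.exists_of_differentiableAt (hA v)
  have h1 : HasFDerivAt (fun w => A w v) _ 0 :=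
    ((ContinuousLinearMap.apply ℂ F v).restrictScalars ℝ).hasFDerivAt.comp (0 : ℂ)
      (differentiableAt_real_of_apply hA).hasFDerivAt
  rw [HasFDerivAt.fderiv h1] at h
  exact h

end OperatorFamilies

/-! ### The action of `y` on the fibre over the origin -/

namespace HomogeneousBundle

variable (E : HomogeneousBundle.{u})

lemma continuousAt_toDisc : ContinuousAt toDisc 0 :=
  (contMDiffAt_toDisc (w := 0) (by simp)).continuousAt

lemma eventually_toDisc_mem_triv : ∀ᶠ w : ℂ in nhds 0, toDisc w ∈ E.triv.baseSet := by
  refine continuousAt_toDisc.eventually_mem (E.triv.open_baseSet.mem_nhds ?_)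
  rw [toDisc_zero]
  exact E.zero_mem_triv

lemma sec_zero : sec 0 = 1 := by
  apply coord.injective
  rw [coord_sec]
  simp [coord]

/-- The image of a vector over the origin under `sec w`. -/
def orbitPoint (w : ℂ) (u : E.Fiber 0) : E.Total := ⟨sec w • (0 : 𝔻), E.act (sec w) 0 u⟩

lemma orbitPoint_proj {w : ℂ} (hw : ‖w‖ < 1) (u : E.Fiber 0) :
    (E.orbitPoint w u).proj = toDisc w := sec_smul_zero hw

lemma differentiableAt_orbitPoint (u : E.Fiber 0) :
    DifferentiableAt ℝ (fun w => (E.triv (E.orbitPoint w u)).2) 0 := by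
  have h0 : ofCoord ((0 : ℂ) * (secFactor 0 : ℂ), 0) • (0 : 𝔻) = 0 := by
    change sec 0 • (0 : 𝔻) = 0
    rw [sec_zero, one_smul]
  have h1 := (E.contDiffAt_orbit u h0).differentiableAt (by simp)
  have h2 : DifferentiableAt ℝ (fun w : ℂ => (w * (secFactor w : ℂ), (0 : ℝ))) 0 :=
    hasFDerivAt_mul_secFactor.differentiableAt.prodMk (differentiableAt_const _)
  have h3 := DifferentiableAt.comp (0 : ℂ) h1 h2
  exact h3

section Frame

variable {V : Type v} [NormedAddCommGroup V] [NormedSpace ℂ V] [FiniteDimensional ℂ V]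
  (κ : V ≃ₗ[ℂ] E.Fiber 0)

/-- The smooth frame near the origin which is obtained by means of the `sec w`. -/
def frame (w : ℂ) : V →L[ℂ] E.F :=
  LinearMap.toContinuousLinearMap
    (E.triv.linearMapAt ℂ (sec w • (0 : 𝔻)) ∘ₗ E.act (sec w) 0 ∘ₗ κ.toLinearMap)

lemma frame_apply {w : ℂ} (hw : ‖w‖ < 1) (hw' : toDisc w ∈ E.triv.baseSet) (v : V) :
    E.frame κ w v = (E.triv (E.orbitPoint w (κ v))).2 := by
  change E.triv.linearMapAt ℂ (sec w • (0 : 𝔻)) _ = _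
  rw [E.triv.coe_linearMapAt_of_mem (by rwa [sec_smul_zero hw])]
  rfl

lemma eventually_frame_apply (v : V) :
    (fun w => E.frame κ w v) =ᶠ[nhds 0] fun w => (E.triv (E.orbitPoint w (κ v))).2 := by
  filter_upwards [eventually_norm_lt_one, E.eventually_toDisc_mem_triv] with w hw hw'
  exact E.frame_apply κ hw hw' v

lemma frame_zero (v : V) : E.frame κ 0 v = E.fiberZero (κ v) := by
  rw [(E.eventually_frame_apply κ v).eq_of_nhds, fiberZero_apply, orbitPoint, sec_zero, E.act_one]

lemma differentiableAt_frame (v : V) : DifferentiableAt ℝ (fun w => E.frame κ w v) 0 :=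
  (E.differentiableAt_orbitPoint (κ v)).congr_of_eventuallyEq (E.eventually_frame_apply κ v)

/-- The action of a group element on the total space. -/
def actTotal (g : CoverSU11) (p : E.Total) : E.Total := ⟨g • p.1, E.act g p.1 p.2⟩

lemma actTotal_actTotal (g h : CoverSU11) (p : E.Total) :
    E.actTotal g (E.actTotal h p) = E.actTotal (g * h) p :=
  (E.act_mul g h p.1 p.2).symm

lemma actTotal_mk (g : CoverSU11) {z w : 𝔻} (h : g • z = w) (v : E.Fiber z) :
    E.actTotal g ⟨z, v⟩ = ⟨w, E.actTo g h v⟩ :=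
  (E.mk_actTo g h v).symm

/-- The action of a rotation in the trivialization near the origin. -/
def rotFrame (t : ℝ) (w : ℂ) : E.F →L[ℂ] E.F :=
  LinearMap.toContinuousLinearMap
    (E.triv.linearMapAt ℂ (rot t • toDisc w) ∘ₗ E.act (rot t) (toDisc w) ∘ₗ
      E.triv.symmₗ ℂ (toDisc w))

lemma norm_exp_mul (t : ℝ) (w : ℂ) : ‖exp (I * t) * w‖ = ‖w‖ := by
  rw [norm_mul, mul_comm I, Complex.norm_exp_ofReal_mul_I, one_mul]

lemma rot_smul_toDisc (t : ℝ) {w : ℂ} (hw : ‖w‖ < 1) :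
    rot t • toDisc w = toDisc (exp (I * t) * w) := by
  rw [← sec_smul_zero hw, ← sec_smul_zero (by rwa [norm_exp_mul]), ← mul_smul, rot_mul_sec,
    mul_smul, rot_smul_zero]

lemma rotFrame_apply (t : ℝ) {w : ℂ} (hw : ‖w‖ < 1) (hw' : toDisc w ∈ E.triv.baseSet)
    (ht : toDisc (exp (I * t) * w) ∈ E.triv.baseSet) (f : E.F) :
    E.rotFrame t w f =
      (E.triv (E.actTotal (rot t) (E.triv.toOpenPartialHomeomorph.symm (toDisc w, f)))).2 := by
  change E.triv.linearMapAt ℂ (rot t • toDisc w)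
    (E.act (rot t) (toDisc w) (E.triv.symmₗ ℂ (toDisc w) f)) = _
  rw [E.triv.coe_linearMapAt_of_mem (by rwa [rot_smul_toDisc t hw]), E.triv.coe_symmₗ (R := ℂ) hw',
    ← E.triv.mk_symm hw']
  rfl

lemma eventually_exp_mul {p : ℂ → Prop} (t : ℝ) (h : ∀ᶠ w in nhds 0, p w) :
    ∀ᶠ w : ℂ in nhds 0, p (exp (I * t) * w) := by
  have hc : ContinuousAt (fun w : ℂ => exp (I * t) * w) 0 := by fun_prop
  exact hc.eventually (by simpa using h)

lemma differentiableAt_rotFrame (t : ℝ) (f : E.F) :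
    DifferentiableAt ℂ (fun w => E.rotFrame t w f) 0 := by
  have h1 : ContMDiffAt 𝓘(ℂ, ℂ) (𝓘(ℂ, ℂ).prod 𝓘(ℂ, E.F)) ω
      (fun w : ℂ => (E.triv.toOpenPartialHomeomorph.symm (toDisc w, f) : E.Total)) 0 := by
    rw [E.triv.contMDiffAt_iff]
    · constructor
      · refine (contMDiffAt_toDisc (w := 0) (by simp)).congr_of_eventuallyEq ?_
        filter_upwards [E.eventually_toDisc_mem_triv] with w hw
        exact E.triv.proj_symm_apply' hw
      · refine (contMDiffAt_const (c := f)).congr_of_eventuallyEq ?_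
        filter_upwards [E.eventually_toDisc_mem_triv] with w hw
        rw [E.triv.apply_symm_apply' hw]
    · rw [E.triv.mem_source, E.triv.proj_symm_apply' (by rw [toDisc_zero]; exact E.zero_mem_triv),
        toDisc_zero]
      exact E.zero_mem_triv
  have h2 := ContMDiffAt.comp (0 : ℂ) (E.holomorphic_act (rot t) _) h1
  have h3 := ((E.triv.contMDiffAt_iff ?_).1 h2).2
  · have h4 := h3.contDiffAt.differentiableAt (by simp)
    refine h4.congr_of_eventuallyEq ?_
    filter_upwards [eventually_norm_lt_one, E.eventually_toDisc_mem_triv,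
      eventually_exp_mul t E.eventually_toDisc_mem_triv] with w hw hw' ht
    exact E.rotFrame_apply t hw hw' ht f
  · rw [E.triv.mem_source]
    change rot t • (E.triv.toOpenPartialHomeomorph.symm (toDisc 0, f)).proj ∈ _
    rw [E.triv.proj_symm_apply' (by rw [toDisc_zero]; exact E.zero_mem_triv), toDisc_zero,
      rot_smul_zero]
    exact E.zero_mem_triv

lemma rotFrame_zero (t : ℝ) (u : E.Fiber 0) :
    E.rotFrame t 0 (E.fiberZero u) = E.fiberZero (E.actTo (rot t) (rot_smul_zero t) u) := by
  have h0 : toDisc 0 ∈ E.triv.baseSet := by rw [toDisc_zero]; exact E.zero_mem_triv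
  rw [E.rotFrame_apply t (by simp) h0 (by rwa [mul_zero]), fiberZero_apply, fiberZero_apply,
    ← actTotal_mk]
  congr 3
  have h1 : ((toDisc 0, (E.triv ⟨0, u⟩).2) : 𝔻 × E.F) =
      ((⟨0, u⟩ : E.Total).proj, (E.triv ⟨0, u⟩).2) := by rw [toDisc_zero]
  rw [h1]
  exact E.triv.symm_apply_mk_proj (E.triv.mem_source.2 E.zero_mem_triv)

lemma rotFrame_frame {Z : V →L[ℂ] V}
    (hκ : ∀ (t : ℝ) (v : V), E.actTo (rot t) (rot_smul_zero t) (κ v) =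
      κ (NormedSpace.exp ((I * (t : ℂ)) • Z) v)) (t : ℝ) (v : V) :
    (fun w => E.rotFrame t w (E.frame κ w v)) =ᶠ[nhds 0]
      fun w => E.frame κ (exp (I * t) * w) (NormedSpace.exp ((I * (t : ℂ)) • Z) v) := by
  filter_upwards [eventually_norm_lt_one, E.eventually_toDisc_mem_triv,
    eventually_exp_mul t E.eventually_toDisc_mem_triv] with w hw hw' ht
  rw [E.rotFrame_apply t hw hw' ht, E.frame_apply κ hw hw',
    E.frame_apply κ (by rwa [norm_exp_mul]) ht]
  have h1 : E.triv.toOpenPartialHomeomorph.symm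
      (toDisc w, (E.triv (E.orbitPoint w (κ v))).2) = E.orbitPoint w (κ v) := by
    rw [← E.orbitPoint_proj hw (κ v)]
    exact E.triv.symm_apply_mk_proj (E.triv.mem_source.2 (by rwa [E.orbitPoint_proj hw]))
  rw [h1, ← hκ]
  congr 2
  change E.actTotal (rot t) (E.actTotal (sec w) ⟨0, κ v⟩) =
    E.actTotal (sec (exp (I * t) * w)) ⟨0, E.actTo (rot t) (rot_smul_zero t) (κ v)⟩
  rw [actTotal_actTotal, ← actTotal_mk, actTotal_actTotal, rot_mul_sec]

/-- The operator `ϱ(y)`, defined by the conjugate linear part of the derivative of `frame`. -/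
lemma exists_rho_y {Z : V →L[ℂ] V}
    (hκ : ∀ (t : ℝ) (v : V), E.actTo (rot t) (rot_smul_zero t) (κ v) =
      κ (NormedSpace.exp ((I * (t : ℂ)) • Z) v)) :
    ∃ Y : V →L[ℂ] V, (∀ v, HasConjDerivAt (fun w => E.frame κ w v) (E.fiberZero (κ (Y v)))) ∧
      ∀ (t : ℝ) (v : V), NormedSpace.exp ((I * (t : ℂ)) • Z) (Y v) =
        exp (-(I * t)) • Y (NormedSpace.exp ((I * (t : ℂ)) • Z) v) := by
  obtain ⟨Q, hQ⟩ := exists_conj_part (E.differentiableAt_frame κ)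
  let e := κ.trans E.fiberZero
  let Y : V →L[ℂ] V := LinearMap.toContinuousLinearMap (e.symm.toLinearMap ∘ₗ Q.toLinearMap)
  have hY : ∀ v, E.fiberZero (κ (Y v)) = Q v := fun v => e.apply_symm_apply (Q v)
  have hQ' : ∀ v, HasConjDerivAt (fun w => E.frame κ w v) (E.fiberZero (κ (Y v))) := fun v => by
    rw [hY]; exact hQ v
  refine ⟨Y, hQ', fun t v => ?_⟩
  have h1 : HasConjDerivAt (fun w => E.rotFrame t w (E.frame κ w v))
      (0 + E.rotFrame t 0 (E.fiberZero (κ (Y v)))) :=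
    HasConjDerivAt.clm_apply
      (fun f => (E.differentiableAt_rotFrame t f).restrictScalars ℝ)
      (.of_differentiableAt (E.differentiableAt_rotFrame t _)) (hQ' v)
  have h2 : HasConjDerivAt
      (fun w => E.frame κ (exp (I * t) * w) (NormedSpace.exp ((I * (t : ℂ)) • Z) v))
      (conj (exp (I * t)) • E.fiberZero (κ (Y (NormedSpace.exp ((I * (t : ℂ)) • Z) v)))) := by
    obtain ⟨P, hP⟩ := hQ' (NormedSpace.exp ((I * (t : ℂ)) • Z) v)
    have hm : HasFDerivAt (𝕜 := ℝ) (fun w : ℂ => exp (I * t) * w)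
        ((exp (I * t) • (1 : ℂ →L[ℂ] ℂ)).restrictScalars ℝ) 0 :=
      (exp (I * t) • (1 : ℂ →L[ℂ] ℂ)).hasFDerivAt.restrictScalars ℝ
    rw [← mul_zero (exp (I * t))] at hP
    refine ⟨P.comp (exp (I * t) • (1 : ℂ →L[ℂ] ℂ)), ?_⟩
    refine (HasFDerivAt.comp (0 : ℂ) hP hm).congr_fderiv (ContinuousLinearMap.ext fun w => ?_)
    change P (exp (I * t) * w) + conj (exp (I * t) * w) • _ =
      P (exp (I * t) * w) + conj w • conj (exp (I * t)) • _
    rw [map_mul (starRingEnd ℂ), smul_smul, mul_comm (conj w)]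
  have h3 := h1.unique (h2.congr (E.rotFrame_frame κ hκ t v))
  rw [zero_add, rotFrame_zero, hκ, ← map_smul, ← map_smul] at h3
  have h4 := κ.injective (E.fiberZero.injective h3)
  rw [h4, ← Complex.exp_conj, map_mul, conj_I, conj_ofReal, neg_mul]

end Frame

end HomogeneousBundle

/-! ### The isomorphism with an induced bundle -/

namespace HomogeneousBundle

variable (E : HomogeneousBundle.{u})

lemma sec_coe_smul_zero (z : 𝔻) : sec (z : ℂ) • (0 : 𝔻) = z := by
  rw [sec_smul_zero z.norm_lt_one, toDisc_coe]

section InducedFrame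

variable {V : Type v} [NormedAddCommGroup V] [NormedSpace ℂ V] [FiniteDimensional ℂ V]
  (κ : V ≃ₗ[ℂ] E.Fiber 0) {Z Y : V →L[ℂ] V} (hZY : Z * Y - Y * Z = -Y)

/-- The multiplier as a linear isomorphism. -/
def multiplierEquiv (g : CoverSU11) {z w : 𝔻} (h : g • z = w) : V ≃ₗ[ℂ] V :=
  LinearEquiv.ofLinearMap (inducedAct Z Y g⁻¹ w).toLinearMap (inducedAct Z Y g z).toLinearMap
    (by
      subst h
      refine LinearMap.ext fun v => ?_
      exact congrArg (fun T : V →L[ℂ] V => T v) (inducedAct_inv_mul Z Y hZY g z))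
    (by
      subst h
      refine LinearMap.ext fun v => ?_
      exact congrArg (fun T : V →L[ℂ] V => T v) (inducedAct_mul_inv Z Y hZY g z))

/-- The equivariant trivialization of a bundle which extends a given isomorphism `κ` with the fibre
over the origin. -/
def inducedFrame (z : 𝔻) : V ≃ₗ[ℂ] E.Fiber z :=
  ((multiplierEquiv hZY (sec z) (sec_coe_smul_zero z)).trans κ).trans
    (E.actEquiv (sec z) (sec_coe_smul_zero z))

lemma inducedFrame_eq (z : 𝔻) (v : V) :
    E.inducedFrame κ hZY z v = E.actTo (sec z) (sec_coe_smul_zero z)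
      (κ (inducedAct Z Y (sec z)⁻¹ z v)) := rfl

/-- The family of operators `inducedFrame` in the trivialization near the origin. -/
def inducedFrameCoord (Z Y : V →L[ℂ] V) (w : ℂ) : V →L[ℂ] E.F :=
  (E.frame κ w).comp (inducedAct Z Y (sec w)⁻¹ (toDisc w))

lemma inducedFrameCoord_apply {w : ℂ} (hw : ‖w‖ < 1) (hw' : toDisc w ∈ E.triv.baseSet) (v : V) :
    (E.triv ⟨toDisc w, E.inducedFrame κ hZY (toDisc w) v⟩).2 = E.inducedFrameCoord κ Z Y w v := by
  rw [inducedFrameCoord, ContinuousLinearMap.comp_apply, E.frame_apply κ hw hw',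
    inducedFrame_eq, mk_actTo, coe_toDisc hw]
  rfl

lemma differentiableAt_inducedFrameCoord
    (hY : ∀ v, HasConjDerivAt (fun w => E.frame κ w v) (E.fiberZero (κ (Y v)))) (v : V) :
    DifferentiableAt ℂ (fun w => E.inducedFrameCoord κ Z Y w v) 0 := by
  have hN : HasConjDerivAt (fun w => inducedAct Z Y (sec w)⁻¹ (toDisc w) v) (-Y v) := by
    refine ⟨0, (hasFDerivAt_inducedAct_sec_inv_apply Z Y
      (hasFDerivAt_const (𝕜 := ℝ) v (0 : ℂ))).congr_fderiv (ContinuousLinearMap.ext fun w => ?_)⟩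
    change (0 : V) - conj w • Y v = (0 : V) + conj w • -Y v
    rw [smul_neg, zero_sub, zero_add]
  have h0 : inducedAct Z Y (sec 0)⁻¹ (toDisc 0) v = v := by
    rw [toDisc_zero, inducedAct_sec_zero]; rfl
  have h1 := HasConjDerivAt.clm_apply (q := E.fiberZero (κ (Y v))) (E.differentiableAt_frame κ)
    (by rw [h0]; exact hY v) hN
  rw [frame_zero, map_neg, map_neg, add_neg_cancel] at h1
  exact h1.differentiableAt

variable (hκ : ∀ (t : ℝ) (v : V), E.actTo (rot t) (rot_smul_zero t) (κ v) =
  κ (NormedSpace.exp ((I * (t : ℂ)) • Z) v))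

include hκ in
lemma inducedFrame_eq_of_smul {g : CoverSU11} {z : 𝔻} (h : g • (0 : 𝔻) = z) (v : V) :
    E.inducedFrame κ hZY z v = E.actTo g h (κ (inducedAct Z Y g⁻¹ z v)) := by
  obtain ⟨t, ht⟩ : ∃ t, (sec z)⁻¹ * g = rot t := by
    apply eq_rot_of_smul_zero
    rw [mul_smul, h, inv_smul_eq_iff, sec_coe_smul_zero]
  obtain rfl : g = sec z * rot t := by rw [← ht, mul_inv_cancel_left]
  have h1 : (sec (z : ℂ))⁻¹ • z = 0 := by rw [inv_smul_eq_iff, sec_coe_smul_zero]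
  have h2 : inducedAct Z Y (sec z * rot t)⁻¹ z v =
      inducedAct Z Y (rot t)⁻¹ 0 (inducedAct Z Y (sec z)⁻¹ z v) := by
    rw [mul_inv_rev, inducedAct_mul Z Y hZY, h1]; rfl
  have h3 : ∀ x, inducedAct Z Y (rot t) 0 (inducedAct Z Y (rot t)⁻¹ 0 x) = x := fun x => by
    have := inducedAct_mul_inv Z Y hZY (rot t) 0
    rw [rot_smul_zero] at this
    exact congrArg (fun T : V →L[ℂ] V => T x) this
  rw [← E.actTo_actTo (rot_smul_zero t) (sec_coe_smul_zero z), hκ, ← inducedAct_rot Z Y t 0, h2, h3,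
    inducedFrame_eq]

include hκ in
/-- The frame is equivariant. -/
lemma act_inducedFrame (g : CoverSU11) (z : 𝔻) (v : V) :
    E.act g z (E.inducedFrame κ hZY z v) =
      E.inducedFrame κ hZY (g • z) (inducedAct Z Y g z v) := by
  have h : (g * sec z) • (0 : 𝔻) = g • z := by rw [mul_smul, sec_coe_smul_zero]
  have h1 : inducedAct Z Y (g * sec z)⁻¹ (g • z) (inducedAct Z Y g z v) =
      inducedAct Z Y (sec z)⁻¹ z v := by
    have h2 := inducedAct_mul Z Y hZY (g * sec z)⁻¹ g z
    rw [mul_inv_rev, inv_mul_cancel_right] at h2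
    rw [mul_inv_rev]
    exact (congrArg (fun T : V →L[ℂ] V => T v) h2).symm
  rw [E.inducedFrame_eq_of_smul κ hZY hκ h, h1, ← actTo_rfl, inducedFrame_eq, actTo_actTo]

variable (hY : ∀ v, HasConjDerivAt (fun w => E.frame κ w v) (E.fiberZero (κ (Y v))))

lemma mdifferentiableAt_smul_toDisc (g : CoverSU11) {w : ℂ} (hw : ‖w‖ < 1) :
    MDifferentiableAt 𝓘(ℂ, ℂ) 𝓘(ℂ, ℂ) (fun w => g • toDisc w) w :=
  ((contMDiff_smul g).contMDiffAt.comp w (contMDiffAt_toDisc hw)).mdifferentiableAt (by simp)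

lemma differentiableAt_inducedAct (g : CoverSU11) {w : ℂ} (hw : ‖w‖ < 1) (v : V) :
    DifferentiableAt ℂ (fun w => inducedAct Z Y g (toDisc w) v) w := by
  obtain ⟨z, rfl⟩ := exists_coe_eq hw
  have h1 : DifferentiableAt ℂ (fun w => inducedActCoord Z Y (coord g) w v) (z : ℂ) :=
    ((contDiffAt_inducedActCoord Z Y (coord g) z).differentiableAt (by simp)).clm_apply
      (differentiableAt_const v)
  refine h1.congr_of_eventuallyEq ?_
  filter_upwards [(isOpen_lt continuous_norm continuous_const).mem_nhds hw] with w hw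
  rw [inducedAct_eq, coe_toDisc hw]

include hκ hY in
/-- The frame is holomorphic. -/
lemma mdifferentiableAt_inducedFrame {w : ℂ} (hw : ‖w‖ < 1) (v : V) :
    MDifferentiableAt 𝓘(ℂ, ℂ) (𝓘(ℂ, ℂ).prod 𝓘(ℂ, E.F))
      (fun w => (⟨toDisc w, E.inducedFrame κ hZY (toDisc w) v⟩ : E.Total)) w := by
  have : ContMDiffVectorBundle 1 E.F E.Fiber 𝓘(ℂ, ℂ) := .of_le (n := ω) (by simp)
  let g := sec w
  let τ : ℂ → E.Total := fun x =>
    ⟨g⁻¹ • toDisc x, E.inducedFrame κ hZY (g⁻¹ • toDisc x) (inducedAct Z Y g⁻¹ (toDisc x) v)⟩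
  have hg : g⁻¹ • toDisc w = 0 := by rw [inv_smul_eq_iff, sec_smul_zero hw]
  have hτ : MDifferentiableAt 𝓘(ℂ, ℂ) (𝓘(ℂ, ℂ).prod 𝓘(ℂ, E.F)) τ w := by
    rw [E.triv.mdifferentiableAt_totalSpace_iff 𝓘(ℂ, ℂ)]
    · have hs := mdifferentiableAt_smul_toDisc g⁻¹ hw
      refine ⟨hs, ?_⟩
      have h1 : DifferentiableAt ℂ (fun x => ((g⁻¹ • toDisc x : 𝔻) : ℂ)) w := by
        have h2 := (contMDiff_isOpenEmbedding (n := ω) (I := 𝓘(ℂ, ℂ))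
          isOpenEmbedding_coe_disc).mdifferentiable (by simp) (g⁻¹ • toDisc w)
        exact (h2.comp w hs).differentiableAt
      have h3 : DifferentiableAt ℂ (E.inducedFrameCoord κ Z Y) ((g⁻¹ • toDisc w : 𝔻) : ℂ) := by
        rw [hg, UnitDisc.coe_zero]
        exact differentiableAt_of_apply (E.differentiableAt_inducedFrameCoord κ hY)
      have h4 := (h3.comp w h1).clm_apply (differentiableAt_inducedAct (Z := Z) (Y := Y) g⁻¹ hw v)
      refine (h4.congr_of_eventuallyEq ?_).mdifferentiableAt
      have h5 : ∀ᶠ x in nhds w, g⁻¹ • toDisc x ∈ E.triv.baseSet := by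
        refine hs.continuousAt.eventually_mem (E.triv.open_baseSet.mem_nhds ?_)
        rw [hg]
        exact E.zero_mem_triv
      filter_upwards [h5] with x hx
      have h6 := E.inducedFrameCoord_apply κ hZY (UnitDisc.norm_lt_one (g⁻¹ • toDisc x))
        (by rwa [toDisc_coe]) (inducedAct Z Y g⁻¹ (toDisc x) v)
      rw [toDisc_coe] at h6
      exact h6
    · rw [E.triv.mem_source]
      change g⁻¹ • toDisc w ∈ _
      rw [hg]
      exact E.zero_mem_triv
  have h7 := ((E.holomorphic_act g).mdifferentiable (by simp) (τ w)).comp w hτ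
  refine h7.congr_of_eventuallyEq (.of_forall fun x => ?_)
  have h8 := E.act_inducedFrame κ hZY hκ g (g⁻¹ • toDisc x) (inducedAct Z Y g⁻¹ (toDisc x) v)
  have h9 : inducedAct Z Y g (g⁻¹ • toDisc x) (inducedAct Z Y g⁻¹ (toDisc x) v) = v := by
    have := inducedAct_mul_inv Z Y hZY g (g⁻¹ • toDisc x)
    rw [smul_inv_smul] at this
    exact congrArg (fun T : V →L[ℂ] V => T v) this
  rw [h9] at h8
  change _ = E.actTotal g (τ x)
  rw [actTotal, h8]
  change _ = (⟨g • g⁻¹ • toDisc x, E.inducedFrame κ hZY (g • g⁻¹ • toDisc x) v⟩ : E.Total)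
  rw [smul_inv_smul]

/-- The frame in the trivialization near a point. -/
def inducedFrameAt (z₀ : 𝔻) (w : ℂ) : V →L[ℂ] E.F :=
  LinearMap.toContinuousLinearMap
    ((trivializationAt E.F E.Fiber z₀).linearMapAt ℂ (toDisc w) ∘ₗ
      (E.inducedFrame κ hZY (toDisc w)).toLinearMap)

lemma inducedFrameAt_coe {z₀ z : 𝔻} (hz : z ∈ (trivializationAt E.F E.Fiber z₀).baseSet) (v : V) :
    E.inducedFrameAt κ hZY z₀ z v =
      (trivializationAt E.F E.Fiber z₀ ⟨z, E.inducedFrame κ hZY z v⟩).2 := by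
  change (trivializationAt E.F E.Fiber z₀).linearMapAt ℂ (toDisc z) _ = _
  rw [toDisc_coe, (trivializationAt E.F E.Fiber z₀).coe_linearMapAt_of_mem hz]
  rfl

include hκ hY in
lemma contDiffAt_inducedFrameAt (z₀ : 𝔻) :
    ContDiffAt ℂ ω (E.inducedFrameAt κ hZY z₀) z₀ := by
  have : ContMDiffVectorBundle 1 E.F E.Fiber 𝓘(ℂ, ℂ) := .of_le (n := ω) (by simp)
  set e := trivializationAt E.F E.Fiber z₀ with he
  let U : Set ℂ := (↑) '' e.baseSet
  have hU : IsOpen U := isOpenEmbedding_coe_disc.isOpenMap _ e.open_baseSet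
  have hz : (z₀ : ℂ) ∈ U := ⟨z₀, FiberBundle.mem_baseSet_trivializationAt' z₀, rfl⟩
  refine contDiffAt_of_apply fun v => ?_
  have hd : DifferentiableOn ℂ (fun w => E.inducedFrameAt κ hZY z₀ w v) U := by
    rintro _ ⟨z, hzb, rfl⟩
    have h1 := E.mdifferentiableAt_inducedFrame κ hZY hκ hY z.norm_lt_one v
    rw [e.mdifferentiableAt_totalSpace_iff 𝓘(ℂ, ℂ)] at h1
    · refine (h1.2.differentiableAt.congr_of_eventuallyEq ?_).differentiableWithinAt
      filter_upwards [hU.mem_nhds ⟨z, hzb, rfl⟩]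
      rintro _ ⟨x, hx, rfl⟩
      rw [E.inducedFrameAt_coe κ hZY hx, toDisc_coe]
    · rw [e.mem_source]
      change toDisc z ∈ _
      rwa [toDisc_coe]
  exact (hd.contDiffOn hU).contDiffAt (hU.mem_nhds hz)

/-- The frame in the trivialization near a point, at a point of the base set. -/
lemma exists_equiv_inducedFrameAt (z₀ : 𝔻) {z : 𝔻}
    (hz : z ∈ (trivializationAt E.F E.Fiber z₀).baseSet) :
    ∃ e : V ≃L[ℂ] E.F, (e : V →L[ℂ] E.F) = E.inducedFrameAt κ hZY z₀ z ∧
      ∀ u : E.Fiber z, e.symm (trivializationAt E.F E.Fiber z₀ ⟨z, u⟩).2 =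
        (E.inducedFrame κ hZY z).symm u := by
  let e := ((E.inducedFrame κ hZY z).trans
    ((trivializationAt E.F E.Fiber z₀).linearEquivAt ℂ z hz)).toContinuousLinearEquiv
  have he : ∀ v, e v = (trivializationAt E.F E.Fiber z₀ ⟨z, E.inducedFrame κ hZY z v⟩).2 :=
    fun v => rfl
  refine ⟨e, ContinuousLinearMap.ext fun v => ?_, fun u => ?_⟩
  · rw [inducedFrameAt_coe _ _ _ hz]
    exact he v
  · rw [ContinuousLinearEquiv.symm_apply_eq, he, LinearEquiv.apply_symm_apply]

include hκ hY in
lemma contMDiff_inducedFrame : ContMDiff (𝓘(ℂ, ℂ).prod 𝓘(ℂ, V)) (𝓘(ℂ, ℂ).prod 𝓘(ℂ, E.F)) ω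
    (fun q : TotalSpace V (Bundle.Trivial 𝔻 V) =>
      (⟨q.1, E.inducedFrame κ hZY q.1 q.2⟩ : E.Total)) := by
  have hbase : ∀ z₀ : 𝔻, ∀ᶠ z in nhds z₀, z ∈ (trivializationAt E.F E.Fiber z₀).baseSet :=
    fun z₀ => (trivializationAt E.F E.Fiber z₀).open_baseSet.mem_nhds
      (FiberBundle.mem_baseSet_trivializationAt' z₀)
  have hcoe : ContMDiff 𝓘(ℂ, ℂ) 𝓘(ℂ, ℂ) ω ((↑) : 𝔻 → ℂ) :=
    contMDiff_isOpenEmbedding isOpenEmbedding_coe_disc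
  intro p
  have hp : ContMDiff (𝓘(ℂ, ℂ).prod 𝓘(ℂ, V)) 𝓘(ℂ, ℂ) ω
      (fun q : TotalSpace V (Bundle.Trivial 𝔻 V) => q.1) := contMDiff_proj _
  rw [contMDiffAt_totalSpace]
  refine ⟨hp p, ?_⟩
  have h2 := (E.contDiffAt_inducedFrameAt κ hZY hκ hY p.1).comp_contMDiffAt
    (f := fun q : TotalSpace V (Bundle.Trivial 𝔻 V) => (q.1 : ℂ)) (x := p)
    (hcoe.contMDiffAt.comp p (hp p))
  have h3 := ((contMDiff_trivial_iff (IM := 𝓘(ℂ, ℂ).prod 𝓘(ℂ, V)) (n := ω)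
    (f := fun q : TotalSpace V (Bundle.Trivial 𝔻 V) => q)).1 contMDiff_id).2 p
  refine (h2.clm_apply h3).congr_of_eventuallyEq ?_
  filter_upwards [hp.continuous.continuousAt.eventually (hbase p.1)] with q hq
  exact (E.inducedFrameAt_coe κ hZY hq _).symm

include hκ hY in
/-- A bundle is induced by the representation on its fibre over the origin. -/
lemma isIsomorphic_inducedBundle : E.IsIsomorphic (inducedBundle Z Y hZY) := by
  have hbase : ∀ z₀ : 𝔻, ∀ᶠ z in nhds z₀, z ∈ (trivializationAt E.F E.Fiber z₀).baseSet :=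
    fun z₀ => (trivializationAt E.F E.Fiber z₀).open_baseSet.mem_nhds
      (FiberBundle.mem_baseSet_trivializationAt' z₀)
  have hcoe : ContMDiff 𝓘(ℂ, ℂ) 𝓘(ℂ, ℂ) ω ((↑) : 𝔻 → ℂ) :=
    contMDiff_isOpenEmbedding isOpenEmbedding_coe_disc
  refine ⟨⟨fun z => (E.inducedFrame κ hZY z).symm, ?_, ?_, fun g z u => ?_⟩⟩
  · refine (contMDiff_trivial_iff (V := V)).2 ⟨contMDiff_proj _, fun p => ?_⟩
    obtain ⟨e, he, -⟩ := E.exists_equiv_inducedFrameAt κ hZY p.1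
      (FiberBundle.mem_baseSet_trivializationAt' p.1)
    have h1 : ContDiffAt ℂ ω (fun w => (E.inducedFrameAt κ hZY p.1 w).inverse) (p.1 : ℂ) := by
      refine ContDiffAt.comp (p.1 : ℂ)
        (g := (ContinuousLinearMap.inverse : (V →L[ℂ] E.F) → (E.F →L[ℂ] V))) ?_
        (E.contDiffAt_inducedFrameAt κ hZY hκ hY p.1)
      rw [← he]
      have : CompleteSpace V := FiniteDimensional.complete ℂ V
      exact contDiffAt_map_inverse e
    have h2 := h1.comp_contMDiffAt (f := fun q : E.Total => (q.1 : ℂ)) (x := p)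
      (hcoe.contMDiffAt.comp p (contMDiffAt_proj E.Fiber))
    have h3 := (contMDiffAt_totalSpace.1
      (contMDiffAt_id (I := 𝓘(ℂ, ℂ).prod 𝓘(ℂ, E.F)) (n := ω) (x := p))).2
    refine (h2.clm_apply h3).congr_of_eventuallyEq ?_
    filter_upwards [(FiberBundle.continuous_proj E.F E.Fiber).continuousAt.eventually
      (hbase p.1)] with q hq
    obtain ⟨e, he, he'⟩ := E.exists_equiv_inducedFrameAt κ hZY p.1 hq
    change (E.inducedFrame κ hZY q.1).symm q.2 =
      (E.inducedFrameAt κ hZY p.1 q.1).inverse (trivializationAt E.F E.Fiber p.1 q).2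
    rw [← he, ContinuousLinearMap.inverse_equiv]
    exact (he' q.2).symm
  · exact E.contMDiff_inducedFrame κ hZY hκ hY
  · change (E.inducedFrame κ hZY (g • z)).symm (E.act g z u) =
      inducedAct Z Y g z ((E.inducedFrame κ hZY z).symm u)
    rw [LinearEquiv.symm_apply_eq, ← E.act_inducedFrame κ hZY hκ, LinearEquiv.apply_symm_apply]

end InducedFrame

lemma exp_rhoH_apply (S : BlockShape) (η t : ℝ) (v : S.Index → ℂ) (p : S.Index) :
    NormedSpace.exp ((I * (t : ℂ)) • S.op (S.rhoH η)) v p =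
      exp (I * t * -((η : ℂ) + ((p.1 : ℕ) : ℂ))) * v p := by
  let D : (S.Index → ℂ) →ₗ[ℂ] (S.Index → ℂ) :=
    Matrix.toLin' (Matrix.diagonal fun p => exp (I * t * -((η : ℂ) + ((p.1 : ℕ) : ℂ))))
  suffices h : (NormedSpace.exp ((I * (t : ℂ)) • S.op (S.rhoH η))).toLinearMap = D by
    have h1 := congrFun (congrArg (fun f : (S.Index → ℂ) →ₗ[ℂ] (S.Index → ℂ) => f v) h) p
    refine h1.trans ?_
    change (Matrix.diagonal _).mulVec v p = _
    rw [Matrix.mulVec_diagonal]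
  refine (Pi.basisFun ℂ S.Index).ext fun q => ?_
  rw [Pi.basisFun_apply]
  refine (S.exp_rhoH_single η t q).trans ?_
  funext x
  change _ = (Matrix.diagonal _).mulVec _ x
  rw [Matrix.mulVec_diagonal, Pi.smul_apply]
  by_cases hq : x = q
  · subst hq; simp
  · simp [hq]

lemma isSubdiagonal_of_exp {S : BlockShape} {η : ℝ} {Y : (S.Index → ℂ) →L[ℂ] (S.Index → ℂ)}
    (hY : ∀ (t : ℝ) (v : S.Index → ℂ),
      NormedSpace.exp ((I * (t : ℂ)) • S.op (S.rhoH η)) (Y v) =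
        exp (-(I * t)) • Y (NormedSpace.exp ((I * (t : ℂ)) • S.op (S.rhoH η)) v)) :
    S.IsSubdiagonal (LinearMap.toMatrix' Y.toLinearMap) := by
  intro p q hpq
  rw [LinearMap.toMatrix'_apply]
  change Y (Pi.single q 1) p = 0
  have hn : ((q.1 : ℕ) : ℝ) - ((p.1 : ℕ) : ℝ) + 1 ≠ 0 := fun h => hpq (by
    have : ((p.1 : ℕ) : ℝ) = ((q.1 : ℕ) : ℝ) + 1 := by linarith
    exact_mod_cast this)
  set n : ℝ := ((q.1 : ℕ) : ℝ) - ((p.1 : ℕ) : ℝ) + 1 with hnd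
  set t : ℝ := Real.pi / n with ht
  have htn : (t : ℂ) * (((q.1 : ℕ) : ℂ) - ((p.1 : ℕ) : ℂ) + 1) = Real.pi := by
    have h : t * n = Real.pi := div_mul_cancel₀ _ hn
    rw [hnd] at h
    exact_mod_cast congrArg (fun x : ℝ => (x : ℂ)) h
  have h := congrFun (hY t (Pi.single q 1)) p
  rw [exp_rhoH_apply, S.exp_rhoH_single, map_smul, smul_smul, Pi.smul_apply, smul_eq_mul, ← Complex.exp_add] at h
  have he : exp (I * t * -((η : ℂ) + ((p.1 : ℕ) : ℂ))) =
      -exp (-(I * t) + I * t * -((η : ℂ) + ((q.1 : ℕ) : ℂ))) := by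
    have : I * t * -((η : ℂ) + ((p.1 : ℕ) : ℂ)) =
        -(I * t) + I * t * -((η : ℂ) + ((q.1 : ℕ) : ℂ)) + Real.pi * I := by
      rw [← htn]; ring
    rw [this, Complex.exp_add _ (Real.pi * I), Complex.exp_pi_mul_I, mul_neg_one]
  rw [he, neg_mul, neg_eq_self] at h
  exact (mul_eq_zero.1 h).resolve_left (Complex.exp_ne_zero _)

/-- An elementary Hermitizable bundle is isomorphic to one of the bundles `E^(η, Y)`. -/
lemma exists_isIsomorphic_bundle (hH : E.IsHermitizable) (hE : E.IsElementary) :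
    ∃ (η : ℝ) (S : BlockShape) (Y : Matrix S.Index S.Index ℂ) (hY : S.IsSubdiagonal Y),
      E.IsIsomorphic (S.bundle η Y hY) := by
  obtain ⟨η, S, κ, hκ⟩ := E.exists_weight_coordinates hH hE
  obtain ⟨Y, hY, hYZ⟩ := E.exists_rho_y κ hκ
  have hop : S.op (LinearMap.toMatrix' Y.toLinearMap) = Y := by
    refine ContinuousLinearMap.ext fun v => ?_
    exact congrArg (fun T : (S.Index → ℂ) →ₗ[ℂ] (S.Index → ℂ) => T v)
      (Matrix.toLin'_toMatrix' Y.toLinearMap)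
  have hsub : S.IsSubdiagonal (LinearMap.toMatrix' Y.toLinearMap) :=
    isSubdiagonal_of_exp hYZ
  refine ⟨η, S, _, hsub, E.isIsomorphic_inducedBundle κ _ hκ ?_⟩
  rwa [hop]

end HomogeneousBundle

end HomogeneousBundles

end

theorem mainTheorem9 :
    (∀ E : HomogeneousBundle.{u}, E.IsHermitizable → E.IsElementary →
      ∃ (η : ℝ) (S : BlockShape) (Y : Matrix S.Index S.Index ℂ) (hY : S.IsSubdiagonal Y),
        E.IsIsomorphic (S.bundle η Y hY)) ∧
    (∀ (S : BlockShape) (η η' : ℝ) (Y Y' : Matrix S.Index S.Index ℂ)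
        (hY : S.IsSubdiagonal Y) (hY' : S.IsSubdiagonal Y'),
      (S.bundle η Y hY).IsIsomorphic (S.bundle η' Y' hY') ↔
        η = η' ∧ ∃ A : Matrix S.Index S.Index ℂ,
          IsUnit A ∧ S.IsBlockDiagonal A ∧ Y' = A * Y * A⁻¹) ∧
    (∀ (S S' : BlockShape) (η η' : ℝ) (Y : Matrix S.Index S.Index ℂ)
        (Y' : Matrix S'.Index S'.Index ℂ) (hY : S.IsSubdiagonal Y) (hY' : S'.IsSubdiagonal Y'),
      (S.bundle η Y hY).IsIsomorphic (S'.bundle η' Y' hY') → S = S') :=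
  ⟨fun E hH hE => E.exists_isIsomorphic_bundle hH hE,
    fun S η η' Y Y' hY hY' => S.isIsomorphic_iff η η' Y Y' hY hY',
    fun _ _ _ _ _ _ _ _ h => (BlockShape.eq_of_isIsomorphic h).2⟩
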